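/- Let $1<\gamma<3$, $b:=-\frac{3-\gamma}{2(\gamma-1)}$ $(<0)$, and let $I=[x_B,x_C]$ with $x_B<x_C$, or $I=[x_B,\infty)$. Let $a\in C^2(I)$ with $a>0$, $a'\ge 0$, and put $k:=a'/a$. Assume that $k$ is $C^1$ on $I$ with bounded $C^1$ norm and that, for some $\delta\in(0,2)$, $$k'(x)\le \frac{k(x)^2}{(2-\delta)b}\qquad (x\in I).$$ Put $$\lambda_1=\tfrac{\gamma+1}{4}S+\tfrac{3-\gamma}{4}R,\qquad \lambda_2=\tfrac{3-\gamma}{4}S+\tfrac{\gamma+1}{4}R,\qquad g=\tfrac{\gamma-1}{8}\,k(x)\,(R^2-S^2),$$ and consider the initial-boundary value problem $$S_t+\lambda_1S_x=g,\quad R_t+\lambda_2R_x=-g\quad (x\in\mathring I,\ t>0),$$ $$(S,R)(x,0)=(S_0,R_0)(x)\ (x\in I),\qquad (S,R)(x_B,t)=(S_B,R_B)(t)\ (t\ge0).\tag{1}$$ For $\nu>0$ and positive functions $S<R$ let $\xi:=R/S-1$ and $\rho:=\left(\frac{\gamma-1}{16\nu}\right)^{\frac1{\gamma-1}}(R-S)^{\frac2{\gamma-1}}$;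 write $\xi_0=R_0/S_0-1$, $\xi_B=R_B/S_B-1$, $\epsilon_0=\ln(S_0\xi_0)$, $\epsilon_B=\ln(S_B\xi_B)$. Given constants $C,M$, call data $(S_0,R_0,S_B,R_B)$ *admissible for $\nu$* if: * $S_0,R_0\in C^1(I)$ and $S_B,R_B\in C^1([0,\infty))$ have bounded $C^1$ norms, $0<S_0<R_0\le M$ on $I$, and $0<S_B<R_B\le M$ on $[0,\infty)$; * $S_0(x_B)=S_B(0)$, $R_0(x_B)=R_B(0)$, $S_B'(0)+\lambda_1S_0'(x_B)=g$ and $R_B'(0)+\lambda_2R_0'(x_B)=-g$, where $\lambda_1,\lambda_2,g$ are evaluated at $x=x_B$, $S=S_0(x_B)$, $R=R_0(x_B)$; * $S_0'\ge0$, $R_0'\ge0$, $\xi_0\le C\sqrt\nu$ on $I$, and $S_B'\le0$, $R_B'\le0$, $\xi_B\le C\sqrt\nu$ on $[0,\infty)$; * for all $x\in I$, if $b\ne-1$, $$\tfrac{kS_0}{2}\Big(\tfrac1{-b}-\tfrac{1}{b+1}\xi_0\Big)\le S_0',\qquad \tfrac{kS_0}{2}\Big(\tfrac1{-b}-\tfrac{1}{b(b+1)}\xi_0\Big)\le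 R_0',$$ and, if $b=-1$, $$\tfrac{kS_0}{2}\big(1-\epsilon_0\xi_0\big)\le S_0',\qquad \tfrac{kS_0}{2}\big(1+\xi_0+\epsilon_0\xi_0\big)\le R_0';$$ * for all $t\ge0$, if $b\neq-1$, $$S_B'\le\tfrac{k(x_B)S_B^2}{2}\Big(\tfrac1b+\tfrac1{b+1}\xi_B+\tfrac{1-b}{2(b+1)(1-2b)}\xi_B^2\Big),\qquad R_B'\le\tfrac{k(x_B)S_B^2}{2}\Big(\tfrac1b+\tfrac{b+2}{b(b+1)}\xi_B-\tfrac{b^2+3b-2}{2b(b+1)(1-2b)}\xi_B^2\Big),$$ and, if $b=-1$, $$S_B'\le\tfrac{k(x_B)S_B^2}{2}\Big(-1+\epsilon_B\xi_B+\tfrac{2\epsilon_B+1}{6}\xi_B^2\Big),\qquad R_B'\le\tfrac{k(x_B)S_B^2}{2}\Big(-1-(\epsilon_B+2)\xi_B-\tfrac{4\epsilon_B+5}{6}\xi_B^2\Big).$$ Then for all constants $C,M$ there is $\nu_*>0$ such that for every $0<\nu\le\nu_*$, all data admissible for $\nu$, and every $C^1$ solution $(S,R)$ of (1) on $I\times[0,\infty)$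 (derivatives continuous up to the boundary), the following holds for $i=1,2$ and every characteristic curve $\Gamma^i:\ \frac{dX}{dt}=\lambda_i\big(S(X(t),t),R(X(t),t)\big)$, $X(t)\in I$, on a time interval $J\subseteq[0,\infty)$. Along $\Gamma^i$ the function $S$ is nondecreasing, and $R$ and $\xi$ are nonincreasing. Moreover, $\xi(X(t),t)\to0$ as $t$ tends to the right end of $J$ if and only if $\rho(X(t),t)\to0$ as $t$ tends to the right end of $J$. -/

import Mathlib

open Set Filter Topology

noncomputable section

namespace DuctFlow

/-- The space interval `I`: either `[x_B, x_C]` with `x_B < x_C`, or `[x_B, ∞)`. -/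
def IsSpaceInterval (xB : ℝ) (I : Set ℝ) : Prop :=
  I = Ici xB ∨ ∃ xC, xB < xC ∧ I = Icc xB xC

/-- A divergent duct: the cross-sectional area `a` is `C²` on `I` with `a > 0` and `a' ≥ 0`
(one-sided derivatives at the end points). -/
structure IsDivergentDuct (I : Set ℝ) (a : ℝ → ℝ) : Prop where
  contDiffOn : ContDiffOn ℝ 2 a I
  pos : ∀ x ∈ I, 0 < a x
  deriv_nonneg : ∀ x ∈ I, 0 ≤ derivWithin a I x

/-- `k = a' / a`. -/
def ductK (I : Set ℝ) (a : ℝ → ℝ) (x : ℝ) : ℝ := derivWithin a I x / a x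

/-- `b = -(3 - γ) / (2 (γ - 1))`. -/
def bExp (γ : ℝ) : ℝ := -(3 - γ) / (2 * (γ - 1))

/-- First characteristic speed in terms of the Riemann invariants. -/
def lam1 (γ s r : ℝ) : ℝ := (γ + 1) / 4 * s + (3 - γ) / 4 * r

/-- Second characteristic speed in terms of the Riemann invariants. -/
def lam2 (γ s r : ℝ) : ℝ := (3 - γ) / 4 * s + (γ + 1) / 4 * r

/-- The two characteristic speeds as a family; index `0` is the first family, `1` the second. -/
def charSpeed (γ : ℝ) (i : Fin 2) (s r : ℝ) : ℝ := ![lam1 γ s r, lam2 γ s r] i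

/-- The source term `(γ - 1) / 8 * k * (R² - S²)`, as a function of the values of `k`, `S`, `R`. -/
def source (γ κ s r : ℝ) : ℝ := (γ - 1) / 8 * κ * (r ^ 2 - s ^ 2)

/-- `ξ = R / S - 1`. -/
def xi (s r : ℝ) : ℝ := r / s - 1

/-- The (rescaled) density recovered from the Riemann invariants
`S, R = v ∓ 2 √(ν / (γ - 1)) ρ ^ ((γ - 1) / 2)`. -/
def density (γ ν s r : ℝ) : ℝ :=
  ((γ - 1) / (16 * ν)) ^ (1 / (γ - 1)) * (r - s) ^ (2 / (γ - 1))

/-- `f` is `C¹` on `D` with bounded `C¹` norm. -/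
def HasBoundedC1 (D : Set ℝ) (f : ℝ → ℝ) : Prop :=
  ContDiffOn ℝ 1 f D ∧ ∃ K : ℝ, ∀ x ∈ D, |f x| ≤ K ∧ |derivWithin f D x| ≤ K

/-- Compatibility of the initial and boundary data at the corner `(x_B, 0)`. -/
structure CornerCompatible (γ xB : ℝ) (I : Set ℝ) (k S₀ R₀ SB RB : ℝ → ℝ) : Prop where
  S_eq : S₀ xB = SB 0
  R_eq : R₀ xB = RB 0
  S_deriv : derivWithin SB (Ici 0) 0 + lam1 γ (S₀ xB) (R₀ xB) * derivWithin S₀ I xB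
    = source γ (k xB) (S₀ xB) (R₀ xB)
  R_deriv : derivWithin RB (Ici 0) 0 + lam2 γ (S₀ xB) (R₀ xB) * derivWithin R₀ I xB
    = -source γ (k xB) (S₀ xB) (R₀ xB)

/-- The lower bounds on `S₀'(x)` and `R₀'(x)`, stated for the numbers `κ = k(x)`, `s = S₀(x)`,
`r = R₀(x)`, `ds = S₀'(x)`, `dr = R₀'(x)`. -/
structure InitialSlope (γ κ s r ds dr : ℝ) : Prop where
  S_of_ne : bExp γ ≠ -1 →
    κ * s / 2 * (1 / -bExp γ - 1 / (bExp γ + 1) * xi s r) ≤ ds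
  S_of_eq : bExp γ = -1 →
    κ * s / 2 * (1 - Real.log (s * xi s r) * xi s r) ≤ ds
  R_of_ne : bExp γ ≠ -1 →
    κ * s / 2 * (1 / -bExp γ - 1 / (bExp γ * (bExp γ + 1)) * xi s r) ≤ dr
  R_of_eq : bExp γ = -1 →
    κ * s / 2 * (1 + xi s r + Real.log (s * xi s r) * xi s r) ≤ dr

/-- The upper bounds on `S_B'(t)` and `R_B'(t)`, stated for the numbers `κ = k(x_B)`, `s = S_B(t)`,
`r = R_B(t)`, `ds = S_B'(t)`, `dr = R_B'(t)`. -/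
structure BoundarySlope (γ κ s r ds dr : ℝ) : Prop where
  S_of_ne : bExp γ ≠ -1 →
    ds ≤ κ * s ^ 2 / 2 * (1 / bExp γ + 1 / (bExp γ + 1) * xi s r
      + (1 - bExp γ) / (2 * (bExp γ + 1) * (1 - 2 * bExp γ)) * xi s r ^ 2)
  S_of_eq : bExp γ = -1 →
    ds ≤ κ * s ^ 2 / 2 * (-1 + Real.log (s * xi s r) * xi s r
      + (2 * Real.log (s * xi s r) + 1) / 6 * xi s r ^ 2)
  R_of_ne : bExp γ ≠ -1 →
    dr ≤ κ * s ^ 2 / 2 * (1 / bExp γ + (bExp γ + 2) / (bExp γ * (bExp γ + 1)) * xi s r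
      - (bExp γ ^ 2 + 3 * bExp γ - 2) / (2 * bExp γ * (bExp γ + 1) * (1 - 2 * bExp γ))
        * xi s r ^ 2)
  R_of_eq : bExp γ = -1 →
    dr ≤ κ * s ^ 2 / 2 * (-1 - (Real.log (s * xi s r) + 2) * xi s r
      - (4 * Real.log (s * xi s r) + 5) / 6 * xi s r ^ 2)

/-- Admissible initial data `S₀, R₀` on `I` and boundary data `SB, RB` on `[0, ∞)` for the
parameter `ν`. The number `C` is the constant in `ξ₀, ξ_B = O(√ν)`, and `M` is a common upper bound
of the data. -/
structure AdmissibleData (γ xB : ℝ) (I : Set ℝ) (k : ℝ → ℝ) (C M ν : ℝ)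
    (S₀ R₀ SB RB : ℝ → ℝ) : Prop where
  corner : CornerCompatible γ xB I k S₀ R₀ SB RB
  S₀_C1 : HasBoundedC1 I S₀
  R₀_C1 : HasBoundedC1 I R₀
  init_pos : ∀ x ∈ I, 0 < S₀ x ∧ S₀ x < R₀ x
  init_le : ∀ x ∈ I, R₀ x ≤ M
  SB_C1 : HasBoundedC1 (Ici 0) SB
  RB_C1 : HasBoundedC1 (Ici 0) RB
  bdry_pos : ∀ t, 0 ≤ t → 0 < SB t ∧ SB t < RB t
  bdry_le : ∀ t, 0 ≤ t → RB t ≤ M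
  init_mono : ∀ x ∈ I, 0 ≤ derivWithin S₀ I x ∧ 0 ≤ derivWithin R₀ I x
  init_xi : ∀ x ∈ I, xi (S₀ x) (R₀ x) ≤ C * √ν
  bdry_mono : ∀ t, 0 ≤ t → derivWithin SB (Ici 0) t ≤ 0 ∧ derivWithin RB (Ici 0) t ≤ 0
  bdry_xi : ∀ t, 0 ≤ t → xi (SB t) (RB t) ≤ C * √ν
  init_slope : ∀ x ∈ I,
    InitialSlope γ (k x) (S₀ x) (R₀ x) (derivWithin S₀ I x) (derivWithin R₀ I x)
  bdry_slope : ∀ t, 0 ≤ t →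
    BoundarySlope γ (k xB) (SB t) (RB t) (derivWithin SB (Ici 0) t) (derivWithin RB (Ici 0) t)

/-- `(S, R)` is a global `C¹` solution, on `I × [0, ∞)`, of the initial-boundary value problem
for the Riemann invariants. -/
structure IsGlobalC1Solution (γ xB : ℝ) (I : Set ℝ) (k S₀ R₀ SB RB : ℝ → ℝ)
    (S R : ℝ → ℝ → ℝ) : Prop where
  S_C1 : ContDiffOn ℝ 1 (fun p : ℝ × ℝ => S p.1 p.2) (I ×ˢ Ici 0)
  R_C1 : ContDiffOn ℝ 1 (fun p : ℝ × ℝ => R p.1 p.2) (I ×ˢ Ici 0)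
  S_eq : ∀ x ∈ interior I, ∀ t, 0 < t →
    deriv (fun τ => S x τ) t + lam1 γ (S x t) (R x t) * deriv (fun y => S y t) x
      = source γ (k x) (S x t) (R x t)
  R_eq : ∀ x ∈ interior I, ∀ t, 0 < t →
    deriv (fun τ => R x τ) t + lam2 γ (S x t) (R x t) * deriv (fun y => R y t) x
      = -source γ (k x) (S x t) (R x t)
  S_init : ∀ x ∈ I, S x 0 = S₀ x
  R_init : ∀ x ∈ I, R x 0 = R₀ x
  S_bdry : ∀ t, 0 ≤ t → S xB t = SB t
  R_bdry : ∀ t, 0 ≤ t → R xB t = RB t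

/-- `t ↦ (X t, t)`, `t ∈ J`, is a characteristic curve of the `i`-th family for `(S, R)`: `J` is
a time interval, the curve stays in `I × [0, ∞)`, and `dX/dt = λ_i(S(X, t), R(X, t))` on `J`. -/
structure IsCharacteristic (γ : ℝ) (I : Set ℝ) (S R : ℝ → ℝ → ℝ) (i : Fin 2)
    (J : Set ℝ) (X : ℝ → ℝ) : Prop where
  interval : J.OrdConnected
  time_nonneg : ∀ t ∈ J, 0 ≤ t
  mem : ∀ t ∈ J, X t ∈ I
  ode : ∀ t ∈ J, HasDerivWithinAt X (charSpeed γ i (S (X t) t) (R (X t) t)) J t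

end DuctFlow

end

/-! Everything follows from the signs `S_t ≤ 0` and `R_t ≤ 0` on the whole domain. Given `0 < S <
R`, one has `g ≥ 0` and `0 < λ₁ < λ₂`. The equations then give `λ₁ (S_t + λ₂ S_x) = λ₂ g - (λ₂ - λ₁)
S_t ≥ 0` and `λ₂ (R_t + λ₁ R_x) = (λ₂ - λ₁) R_t - λ₁ g ≤ 0`, so `S` rises and `R` falls along both
families, and `ξ = R/S - 1` falls with them. Moreover `S` is then bounded below and `R` above along
a curve, so `ξ → 0` and `ρ → 0` both mean `R - S → 0`.

The signs of `S_t`, `R_t` come from a comparison argument. Formally, `σ = -S_t` and `τ = -R_t` solve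
a linear transport system in which `τ` enters the `σ` equation with coefficient `(γ-1)/4 k R -
(3-γ)/4 S_x`, and `σ` enters the `τ` equation with `(γ-1)/4 k S - (3-γ)/4 R_x`. Nonnegativity of `σ`
and `τ` propagates if these coefficients are nonnegative, and this is needed only where the sign in
question fails. There the equation itself helps: `S_t > 0` gives `S_x < g/λ₁`, and `(3-γ)/4 g/λ₁ ≤
(γ-1)/4 k R` is an algebraic fact; `R_t > 0` gives `R_x < 0`.

The solution is only `C¹`, so `S_t` and `R_t` are replaced by difference quotients in time, with an
error `η` sent to zero (`slow_quotient_lower_bound`, `fast_quotient_lower_bound`,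
`coupled_transport_lower_bound`, `time_deriv_nonpos`). Speeds are nonnegative, so on `[x_B, L] × [0,
T]` only the left and bottom sides need data. On the left side the signs are assumed; at `t = 0`
they follow from the equations, since `g = O(ξ₀)` is dominated by `λ₁ S₀'` for small `ξ₀`
(`InitialSlope.exists_source_le`). -/

namespace DuctFlow

/-! ### Minimum principles for transport with nonnegative speed -/

/-- At a minimum over the rectangle away from the left and bottom sides, the derivative in a
direction `(c, 1)` with `c ≥ 0` is nonpositive. -/
theorem deriv_transport_nonpos_of_isMinOn {f : ℝ × ℝ → ℝ} {f' : ℝ × ℝ →L[ℝ] ℝ} {x₀ L T c : ℝ}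
    {z : ℝ × ℝ} (hz : z ∈ Icc x₀ L ×ˢ Icc 0 T) (hmin : IsMinOn f (Icc x₀ L ×ˢ Icc 0 T) z)
    (hf : HasFDerivWithinAt f f' (Icc x₀ L ×ˢ Icc 0 T) z) (hx : x₀ < z.1) (ht : 0 < z.2)
    (hc : 0 ≤ c) : f' (c, 1) ≤ 0 := by
  obtain ⟨⟨-, hzL⟩, -, hzT⟩ := hz
  -- A step length for which `z - r (c, 1)` stays in the rectangle. The denominator `c + 1` also
  -- covers `c = 0`.
  set r := min z.2 ((z.1 - x₀) / (c + 1)) with hr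
  have hr0 : 0 < r := lt_min ht (div_pos (by linarith) (by linarith))
  have hr1 : r ≤ z.2 := min_le_left _ _
  have hr2 : r * (c + 1) ≤ z.1 - x₀ := by
    rw [← le_div_iff₀ (by linarith)]; exact min_le_right _ _
  have hrc : 0 ≤ r * c := mul_nonneg hr0.le hc
  have key := hmin.localize.hasFDerivWithinAt_nonneg hf (y := (-r) • (c, (1 : ℝ)))
    (mem_posTangentConeAt_of_segment_subset (((convex_Icc _ _).prod (convex_Icc _ _)).segment_subset
      ⟨⟨hx.le, hzL⟩, ht.le, hzT⟩ ?_))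
  · rw [map_smul, smul_eq_mul] at key
    nlinarith
  · simp only [mem_prod, mem_Icc, Prod.fst_add, Prod.snd_add, Prod.smul_mk, smul_eq_mul]
    refine ⟨⟨?_, ?_⟩, ?_, ?_⟩ <;> nlinarith

theorem isCompact_rectangle (x₀ L T : ℝ) : IsCompact (Icc x₀ L ×ˢ Icc 0 T : Set (ℝ × ℝ)) :=
  isCompact_Icc.prod isCompact_Icc

/-- Weak maximum principle for transport with nonnegative speed. -/
theorem le_of_transport_nonneg {f : ℝ × ℝ → ℝ} {f' : ℝ × ℝ → ℝ × ℝ →L[ℝ] ℝ} {c : ℝ × ℝ → ℝ}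
    {x₀ L T m : ℝ}
    (hf : ∀ z ∈ Icc x₀ L ×ˢ Icc 0 T, HasFDerivWithinAt f (f' z) (Icc x₀ L ×ˢ Icc 0 T) z)
    (hc : ∀ z ∈ Icc x₀ L ×ˢ Icc 0 T, 0 ≤ c z)
    (htr : ∀ z ∈ Icc x₀ L ×ˢ Icc 0 T, 0 ≤ f' z (c z, 1))
    (hinit : ∀ x ∈ Icc x₀ L, m ≤ f (x, 0)) (hbd : ∀ t ∈ Icc 0 T, m ≤ f (x₀, t)) :
    ∀ z ∈ Icc x₀ L ×ˢ Icc 0 T, m ≤ f z := by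
  intro z hz
  have hT : 0 ≤ T := hz.2.1.trans hz.2.2
  -- Adding `ε t` makes the transport derivative strictly positive, which excludes a minimum off the
  -- left and bottom sides.
  have key : ∀ ε > 0, m ≤ f z + ε * T := by
    intro ε hε
    have hf₁ : ∀ y ∈ Icc x₀ L ×ˢ Icc 0 T, HasFDerivWithinAt (fun y => f y + ε * y.2)
        (f' y + ε • ContinuousLinearMap.snd ℝ ℝ ℝ) (Icc x₀ L ×ˢ Icc 0 T) y := fun y hy =>
      (hf y hy).add (hasFDerivWithinAt_snd.const_mul ε)
    obtain ⟨y, hy, hmin⟩ := (isCompact_rectangle x₀ L T).exists_isMinOn ⟨z, hz⟩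
      (fun y hy => (hf₁ y hy).continuousWithinAt)
    have h1 : f y + ε * y.2 ≤ f z + ε * z.2 := hmin hz
    have h2 : m ≤ f y := by
      rcases hy.1.1.eq_or_lt with hx | hx
      · have := hbd y.2 hy.2
        rwa [hx] at this
      rcases hy.2.1.eq_or_lt with ht | ht
      · have := hinit y.1 hy.1
        rwa [ht] at this
      have h3 := deriv_transport_nonpos_of_isMinOn hy hmin (hf₁ y hy) hx ht (hc y hy)
      have h4 := htr y hy
      simp at h3
      linarith
    have h5 := hy.2.1
    have h6 := hz.2.2
    nlinarith
  by_contra! hlt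
  have h := key ((m - f z) / (2 * (T + 1))) (div_pos (by linarith) (by linarith))
  have : (m - f z) / (2 * (T + 1)) * T ≤ (m - f z) / 2 := by
    rw [div_mul_eq_mul_div, div_le_div_iff₀ (by linarith) (by norm_num)]
    nlinarith
  linarith

/-- Lower bound for a pair of functions, each transported with nonnegative speed, in which the
smaller of the two cannot decrease faster than exponentially. -/
theorem coupled_transport_lower_bound {D E : ℝ × ℝ → ℝ} {D' E' : ℝ × ℝ → ℝ × ℝ →L[ℝ] ℝ}
    {c d : ℝ × ℝ → ℝ} {x₀ L T K η : ℝ} (hη : 0 < η) (hK : 0 ≤ K)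
    (hD : ∀ z ∈ Icc x₀ L ×ˢ Icc 0 T, HasFDerivWithinAt D (D' z) (Icc x₀ L ×ˢ Icc 0 T) z)
    (hE : ∀ z ∈ Icc x₀ L ×ˢ Icc 0 T, HasFDerivWithinAt E (E' z) (Icc x₀ L ×ˢ Icc 0 T) z)
    (hc : ∀ z ∈ Icc x₀ L ×ˢ Icc 0 T, 0 ≤ c z) (hd : ∀ z ∈ Icc x₀ L ×ˢ Icc 0 T, 0 ≤ d z)
    (hinit : ∀ x ∈ Icc x₀ L, -η ≤ D (x, 0) ∧ -η ≤ E (x, 0))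
    (hbd : ∀ t ∈ Icc 0 T, -η ≤ D (x₀, t) ∧ -η ≤ E (x₀, t))
    (htrD : ∀ z ∈ Icc x₀ L ×ˢ Icc 0 T, D z < -η → D z ≤ E z → K * D z < D' z (c z, 1))
    (htrE : ∀ z ∈ Icc x₀ L ×ˢ Icc 0 T, E z < -η → E z ≤ D z → K * E z < E' z (d z, 1)) :
    ∀ z ∈ Icc x₀ L ×ˢ Icc 0 T, -(η * Real.exp (K * T)) ≤ D z ∧ -(η * Real.exp (K * T)) ≤ E z := by
  intro z hz
  set Q : Set (ℝ × ℝ) := Icc x₀ L ×ˢ Icc 0 T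
  have hexp : ∀ y : ℝ × ℝ, HasFDerivWithinAt (fun y : ℝ × ℝ => Real.exp (-K * y.2))
      (Real.exp (-K * y.2) • -K • ContinuousLinearMap.snd ℝ ℝ ℝ) Q y := fun y =>
    (hasFDerivWithinAt_snd.const_mul (-K)).exp
  have hmul : ∀ {f : ℝ × ℝ → ℝ} {f' : ℝ × ℝ →L[ℝ] ℝ} {y : ℝ × ℝ} {v : ℝ}, y ∈ Q →
      HasFDerivWithinAt f f' Q y → x₀ < y.1 → 0 < y.2 → 0 ≤ v →
      IsMinOn (fun y => Real.exp (-K * y.2) * f y) Q y → f' (v, 1) ≤ K * f y := by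
    intro f f' y v hy hf hx ht hv hmin
    have h := deriv_transport_nonpos_of_isMinOn hy hmin ((hexp y).mul hf) hx ht hv
    have hpos := Real.exp_pos (-K * y.2)
    simp at h
    simp at hpos
    by_contra! hlt
    nlinarith
  -- With the weight `e^{-Kt}`, an interior minimum forces `f' (v, 1) ≤ K f` for whichever of `D`,
  -- `E` is smaller there, against the assumed strict inequality.
  obtain ⟨y, hy, hmin⟩ := (isCompact_rectangle x₀ L T).exists_isMinOn ⟨z, hz⟩
    (f := fun y => Real.exp (-K * y.2) * min (D y) (E y))
    (fun y hy => (hexp y).continuousWithinAt.mul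
      ((hD y hy).continuousWithinAt.min (hE y hy).continuousWithinAt))
  have hle1 : ∀ y ∈ Q, Real.exp (-K * y.2) ≤ 1 := fun y hy => by
    rw [Real.exp_le_one_iff]
    have := mul_nonneg hK hy.2.1
    linarith
  have main : -η ≤ Real.exp (-K * y.2) * min (D y) (E y) := by
    have hpos := Real.exp_pos (-K * y.2)
    have h1 := hle1 y hy
    by_contra! hlt
    have hneg : min (D y) (E y) < -η := by
      by_contra! h
      nlinarith
    have hx : x₀ < y.1 := by
      refine lt_of_le_of_ne hy.1.1 fun hx => hneg.not_ge ?_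
      have := hbd y.2 hy.2
      rw [hx] at this
      exact le_min this.1 this.2
    have ht : 0 < y.2 := by
      refine lt_of_le_of_ne hy.2.1 fun ht => hneg.not_ge ?_
      have := hinit y.1 hy.1
      rw [ht] at this
      exact le_min this.1 this.2
    rcases le_total (D y) (E y) with hDE | hDE
    · rw [min_eq_left hDE] at hneg
      -- Since `D` lies above the minimum of the pair and equals it at `y`, the weighted `D` alone
      -- is also minimal at `y`.
      refine (htrD y hy hneg hDE).not_ge (hmul hy (hD y hy) hx ht (hc y hy) fun w hw => ?_)
      have h2 := hmin hw
      simp only [mem_ofPred_eq, min_eq_left hDE] at h2 ⊢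
      exact h2.trans (mul_le_mul_of_nonneg_left (min_le_left _ _) (Real.exp_pos _).le)
    · rw [min_eq_right hDE] at hneg
      refine (htrE y hy hneg hDE).not_ge (hmul hy (hE y hy) hx ht (hd y hy) fun w hw => ?_)
      have h2 := hmin hw
      simp only [mem_ofPred_eq, min_eq_right hDE] at h2 ⊢
      exact h2.trans (mul_le_mul_of_nonneg_left (min_le_right _ _) (Real.exp_pos _).le)
  have h3 : -η ≤ Real.exp (-K * z.2) * min (D z) (E z) := main.trans (hmin hz)
  have h4 : -(η * Real.exp (K * z.2)) ≤ min (D z) (E z) := by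
    have h5 : Real.exp (K * z.2) * Real.exp (-K * z.2) = 1 := by
      rw [← Real.exp_add]; simp
    have h6 := mul_le_mul_of_nonneg_left h3 (Real.exp_pos (K * z.2)).le
    rw [← mul_assoc, h5] at h6
    linarith
  have h7 : Real.exp (K * z.2) ≤ Real.exp (K * T) :=
    Real.exp_le_exp.2 (mul_le_mul_of_nonneg_left hz.2.2 hK)
  have h8 : -(η * Real.exp (K * T)) ≤ min (D z) (E z) := by nlinarith
  exact le_min_iff.1 h8

/-! ### Riemann flows and the absence of vacuum -/

/-- A `C¹` solution of the Riemann invariant system up to the boundary of `I × [0, ∞)`, with total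
derivatives `S'`, `R'`. -/
structure IsRiemannFlow (γ xB : ℝ) (I : Set ℝ) (k : ℝ → ℝ) (S R : ℝ × ℝ → ℝ)
    (S' R' : ℝ × ℝ → ℝ × ℝ →L[ℝ] ℝ) : Prop where
  one_lt : 1 < γ
  lt_three : γ < 3
  left_le : ∀ x ∈ I, xB ≤ x
  Icc_subset : ∀ x ∈ I, Icc xB x ⊆ I
  k_nonneg : ∀ x ∈ I, 0 ≤ k x
  k_cont : ContinuousOn k I
  S_hasDeriv : ∀ z ∈ I ×ˢ Ici 0, HasFDerivWithinAt S (S' z) (I ×ˢ Ici 0) z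
  R_hasDeriv : ∀ z ∈ I ×ˢ Ici 0, HasFDerivWithinAt R (R' z) (I ×ˢ Ici 0) z
  S'_cont : ContinuousOn S' (I ×ˢ Ici 0)
  R'_cont : ContinuousOn R' (I ×ˢ Ici 0)
  S_eq : ∀ z ∈ I ×ˢ Ici 0, S' z (lam1 γ (S z) (R z), 1) = source γ (k z.1) (S z) (R z)
  R_eq : ∀ z ∈ I ×ˢ Ici 0, R' z (lam2 γ (S z) (R z), 1) = -source γ (k z.1) (S z) (R z)

theorem clm_change_speed (f : ℝ × ℝ →L[ℝ] ℝ) (c d : ℝ) :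
    f (c, 1) = f (d, 1) + (c - d) * f (1, 0) := by
  have : ((c, 1) : ℝ × ℝ) = (d, 1) + (c - d) • (1, 0) := by simp
  rw [this, map_add, map_smul, smul_eq_mul]

theorem clm_speed (f : ℝ × ℝ →L[ℝ] ℝ) (c : ℝ) : f (c, 1) = f (0, 1) + c * f (1, 0) := by
  simpa using clm_change_speed f c 0

namespace IsRiemannFlow

variable {γ xB : ℝ} {I : Set ℝ} {k : ℝ → ℝ} {S R : ℝ × ℝ → ℝ} {S' R' : ℝ × ℝ → ℝ × ℝ →L[ℝ] ℝ}

theorem rectangle_subset (h : IsRiemannFlow γ xB I k S R S' R') {L : ℝ} (hL : L ∈ I) (T : ℝ) :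
    Icc xB L ×ˢ Icc 0 T ⊆ I ×ˢ Ici (0 : ℝ) :=
  prod_mono (h.Icc_subset L hL) Icc_subset_Ici_self

theorem S_cont (h : IsRiemannFlow γ xB I k S R S' R') : ContinuousOn S (I ×ˢ Ici 0) :=
  fun z hz => (h.S_hasDeriv z hz).continuousWithinAt

theorem R_cont (h : IsRiemannFlow γ xB I k S R S' R') : ContinuousOn R (I ×ˢ Ici 0) :=
  fun z hz => (h.R_hasDeriv z hz).continuousWithinAt

theorem exists_bound (h : IsRiemannFlow γ xB I k S R S' R') {f : ℝ × ℝ → ℝ}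
    (hf : ContinuousOn f (I ×ˢ Ici 0)) {L : ℝ} (hL : L ∈ I) (T : ℝ) :
    ∃ B, ∀ z ∈ Icc xB L ×ˢ Icc 0 T, |f z| ≤ B :=
  (isCompact_rectangle xB L T).exists_bound_of_continuousOn (hf.mono (h.rectangle_subset hL T))

/-- Nonnegative Riemann invariants with `S ≤ R` and strictly ordered positive data are positive and
strictly ordered. -/
theorem pos_of_nonneg (h : IsRiemannFlow γ xB I k S R S' R')
    (hinit : ∀ x ∈ I, 0 < S (x, 0) ∧ S (x, 0) < R (x, 0))
    (hbd : ∀ t, 0 ≤ t → 0 < S (xB, t) ∧ S (xB, t) < R (xB, t)) {L T : ℝ} (hL : L ∈ I)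
    (hT : 0 ≤ T) (hnn : ∀ z ∈ Icc xB L ×ˢ Icc 0 T, 0 ≤ S z ∧ S z ≤ R z) :
    ∀ z ∈ Icc xB L ×ˢ Icc 0 T, 0 < S z ∧ S z < R z := by
  have h1 := h.one_lt
  have h3 := h.lt_three
  have hsub := h.rectangle_subset hL T
  have hxBL := h.left_le L hL
  have hIL := h.Icc_subset L hL
  have hlam : ∀ z ∈ Icc xB L ×ˢ Icc 0 T, 0 ≤ lam1 γ (S z) (R z) := by
    intro z hz
    obtain ⟨hs, hr⟩ := hnn z hz
    unfold lam1
    have := mul_nonneg (by linarith : 0 ≤ (γ + 1) / 4) hs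
    have := mul_nonneg (by linarith : 0 ≤ (3 - γ) / 4) (hs.trans hr)
    linarith
  have lower : ∀ f : ℝ × ℝ → ℝ, ContinuousOn f (I ×ˢ Ici 0) → (∀ x ∈ I, 0 < f (x, 0)) →
      (∀ t, 0 ≤ t → 0 < f (xB, t)) → ∃ m > 0, (∀ x ∈ Icc xB L, m ≤ f (x, 0)) ∧
        ∀ t ∈ Icc 0 T, m ≤ f (xB, t) := by
    intro f hf hf0 hfB
    have c1 : ContinuousOn (fun x : ℝ => f (x, 0)) (Icc xB L) :=
      hf.comp (by fun_prop) fun x hx => ⟨hIL hx, le_refl (0 : ℝ)⟩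
    have c2 : ContinuousOn (fun t : ℝ => f (xB, t)) (Icc 0 T) :=
      hf.comp (by fun_prop) fun t ht => ⟨hIL ⟨le_rfl, hxBL⟩, ht.1⟩
    obtain ⟨x, hx, hxm⟩ := isCompact_Icc.exists_isMinOn (nonempty_Icc.2 hxBL) c1
    obtain ⟨t, ht, htm⟩ := isCompact_Icc.exists_isMinOn (nonempty_Icc.2 hT) c2
    exact ⟨min (f (x, 0)) (f (xB, t)), lt_min (hf0 x (hIL hx)) (hfB t ht.1),
      fun y hy => (min_le_left _ _).trans (hxm hy), fun y hy => (min_le_right _ _).trans (htm hy)⟩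
  intro z hz
  constructor
  · obtain ⟨m, hm, m1, m2⟩ := lower S h.S_cont (fun x hx => (hinit x hx).1) fun t ht => (hbd t ht).1
    refine hm.trans_le (le_of_transport_nonneg (fun z hz => (h.S_hasDeriv z (hsub hz)).mono hsub)
      hlam ?_ m1 m2 z hz)
    intro z hz
    rw [h.S_eq z (hsub hz)]
    obtain ⟨hs, hr⟩ := hnn z hz
    have := h.k_nonneg z.1 (hsub hz).1
    unfold source
    exact mul_nonneg (mul_nonneg (by linarith) this) (by nlinarith)
  -- Along the first family, `R - S` satisfies a linear homogeneous equation, because `λ₂ - λ₁ =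
  -- (γ-1)/2 (R - S)`. With `K` bounding its decay rate, `e^{Kt} (R - S)` does not decrease.
  · have hcoef : ContinuousOn (fun z : ℝ × ℝ => (γ - 1) / 4 * k z.1 * (R z + S z)
        + (γ - 1) / 2 * R' z (1, 0)) (I ×ˢ Ici 0) :=
      ((continuousOn_const.mul (h.k_cont.comp continuousOn_fst fun z hz => hz.1)).mul
        (h.R_cont.add h.S_cont)).add
        (continuousOn_const.mul (h.R'_cont.clm_apply continuousOn_const))
    obtain ⟨K, hK⟩ := h.exists_bound hcoef hL T
    set f : ℝ × ℝ → ℝ := fun z => Real.exp (K * z.2) * (R z - S z) with hf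
    have hfc : ContinuousOn f (I ×ˢ Ici 0) :=
      (by fun_prop : Continuous fun z : ℝ × ℝ => Real.exp (K * z.2)).continuousOn.mul
        (h.R_cont.sub h.S_cont)
    obtain ⟨m, hm, m1, m2⟩ := lower f hfc
      (fun x hx => mul_pos (Real.exp_pos _) (by linarith [(hinit x hx).2]))
      fun t ht => mul_pos (Real.exp_pos _) (by linarith [(hbd t ht).2])
    have hfd : ∀ z ∈ Icc xB L ×ˢ Icc 0 T, HasFDerivWithinAt f
        (Real.exp (K * z.2) • (R' z - S' z) +
          (R z - S z) • Real.exp (K * z.2) • K • ContinuousLinearMap.snd ℝ ℝ ℝ)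
        (Icc xB L ×ˢ Icc 0 T) z := fun z hz =>
      ((hasFDerivWithinAt_snd.const_mul K).exp).mul
        (((h.R_hasDeriv z (hsub hz)).sub (h.S_hasDeriv z (hsub hz))).mono hsub)
    have hmz : m ≤ f z := by
      refine le_of_transport_nonneg hfd hlam ?_ m1 m2 z hz
      intro z hz
      have e1 := h.S_eq z (hsub hz)
      have e2 := clm_change_speed (R' z) (lam1 γ (S z) (R z)) (lam2 γ (S z) (R z))
      rw [h.R_eq z (hsub hz)] at e2
      have hKz := (abs_le.1 (hK z hz)).2
      have : (Real.exp (K * z.2) • (R' z - S' z) +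
          (R z - S z) • Real.exp (K * z.2) • K • ContinuousLinearMap.snd ℝ ℝ ℝ)
          (lam1 γ (S z) (R z), 1) = Real.exp (K * z.2) * ((R z - S z) *
            (K - ((γ - 1) / 4 * k z.1 * (R z + S z) + (γ - 1) / 2 * R' z (1, 0)))) := by
        simp only [add_apply, smul_apply, sub_apply, smul_eq_mul,
          ContinuousLinearMap.coe_snd', e1, e2]
        unfold source lam1 lam2
        ring
      rw [this]
      exact mul_nonneg (Real.exp_pos _).le (mul_nonneg (by linarith [(hnn z hz).2]) (by linarith))
    have hfz : 0 < Real.exp (K * z.2) * (R z - S z) := hm.trans_le hmz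
    have := pos_of_mul_pos_right hfz (Real.exp_pos _).le
    linarith

/-- No vacuum forms and the velocities stay positive. -/
theorem pos (h : IsRiemannFlow γ xB I k S R S' R')
    (hinit : ∀ x ∈ I, 0 < S (x, 0) ∧ S (x, 0) < R (x, 0))
    (hbd : ∀ t, 0 ≤ t → 0 < S (xB, t) ∧ S (xB, t) < R (xB, t)) :
    ∀ z ∈ I ×ˢ Ici 0, 0 < S z ∧ S z < R z := by
  rintro ⟨L, T⟩ ⟨hL, hT⟩
  simp only [mem_Ici] at hL hT
  by_contra hbad
  set f : ℝ × ℝ → ℝ := fun z => min (S z) (R z - S z) with hf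
  have hfpos : ∀ z, 0 < f z ↔ 0 < S z ∧ S z < R z := fun z => by simp [hf]
  have hfc : ContinuousOn f (I ×ˢ Ici 0) := fun z hz =>
    (h.S_cont z hz).min ((h.R_cont z hz).sub (h.S_cont z hz))
  have hcpt : IsCompact ((Icc xB L ×ˢ Icc 0 T) ∩ f ⁻¹' Iic 0) :=
    (isCompact_rectangle xB L T).of_isClosed_subset
      ((hfc.mono (h.rectangle_subset hL T)).preimage_isClosed_of_isClosed
        (isClosed_Icc.prod isClosed_Icc) isClosed_Iic) inter_subset_left
  -- A point of failure with the earliest time. Up to that time the weak inequalities hold, by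
  -- continuity at the final instant, and `pos_of_nonneg` makes them strict.
  obtain ⟨y, ⟨hy, hy0⟩, hymin⟩ := hcpt.exists_isMinOn (f := Prod.snd)
    ⟨(L, T), ⟨⟨⟨h.left_le L hL, le_rfl⟩, hT, le_rfl⟩, by
      rw [← hfpos, not_lt] at hbad; exact hbad⟩⟩ continuousOn_snd
  have hbefore : ∀ z ∈ Icc xB L ×ˢ Ico 0 y.2, 0 ≤ f z := by
    intro z hz
    by_contra! hneg
    have : y.2 ≤ z.2 := hymin ⟨⟨hz.1, hz.2.1, hz.2.2.le.trans hy.2.2⟩, hneg.le⟩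
    exact this.not_gt hz.2.2
  have hyt : 0 < y.2 := by
    refine lt_of_le_of_ne hy.2.1 fun h0 => ?_
    have hi := (hfpos _).2 (hinit y.1 (h.Icc_subset L hL hy.1))
    rw [(Prod.ext rfl h0 : ((y.1, 0) : ℝ × ℝ) = y)] at hi
    exact (not_lt.2 hy0) hi
  have hupto : ∀ z ∈ Icc xB L ×ˢ Icc 0 y.2, 0 ≤ f z := by
    intro z hz
    have hcl : z ∈ closure (Icc xB L ×ˢ Ico 0 y.2) := by
      rw [closure_prod_eq, closure_Ico hyt.ne, isClosed_Icc.closure_eq]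
      exact hz
    have hm : Icc xB L ×ˢ Ico 0 y.2 ⊆ I ×ˢ Ici 0 :=
      prod_mono (h.Icc_subset L hL) Ico_subset_Ici_self
    exact closure_minimal (image_subset_iff.2 hbefore) isClosed_Ici
      (((hfc z (h.rectangle_subset hL _ hz)).mono hm).mem_closure_image hcl)
  have := h.pos_of_nonneg hinit hbd hL hyt.le (fun z hz => by
    have := hupto z hz
    simp only [hf, le_min_iff] at this
    exact ⟨this.1, by linarith [this.2]⟩) y ⟨hy.1, hyt.le, le_rfl⟩
  exact (not_lt.2 hy0) ((hfpos y).2 this)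

end IsRiemannFlow

/-! ### Algebra of the differenced system -/

/-- Lower bound for a product `A * E` with `E ≥ -d`, where `A` is almost nonnegative if `E > 0`. -/
theorem neg_mul_le_mul_of_bounds {A E B C η d : ℝ} (hA : |A| ≤ B) (hE : E ≤ B) (hEd : -d ≤ E)
    (hd : η ≤ d) (hη : 0 < η) (hC : 0 ≤ C) (hpos : 0 < E → -(C * η) ≤ A) :
    -((B + C * B) * d) ≤ A * E := by
  have hB : 0 ≤ B := (abs_nonneg A).trans hA
  obtain ⟨hA1, hA2⟩ := abs_le.1 hA
  have hd0 : 0 ≤ d := hη.le.trans hd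
  have hCB : 0 ≤ C * B * d := by positivity
  rcases le_or_gt E 0 with h | h
  -- For `E ≤ 0` one has `|E| ≤ d`, so the size of `A` suffices; the sign of `A` matters only for `E
  -- > 0`.
  · nlinarith
  · have h1 := hpos h
    have h2 : C * η * E ≤ C * d * B := by gcongr
    nlinarith [mul_nonneg hB hd0]

/-- The source divided by the characteristic speed is dominated by `k R`. -/
theorem source_div_speed_le {γ κ s r p u l : ℝ} (h1 : 1 < γ) (h3 : γ < 3) (hκ : 0 ≤ κ)
    (hs : 0 < s) (hr : s < r) {m : ℝ} (hm : 0 < m) (hml : m ≤ l) (hl : lam1 γ s r = l)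
    (hp : l * p = source γ κ s r + u) {η : ℝ} (hη : 0 < η) (hu : u ≤ η) :
    (3 - γ) / 4 * p ≤ (γ - 1) / 4 * κ * r + η / m := by
  have hl0 : 0 < l := hm.trans_le hml
  have e1 : (3 - γ) / 4 * source γ κ s r ≤ l * ((γ - 1) / 4 * κ * r) := by
    have : l * ((γ - 1) / 4 * κ * r) - (3 - γ) / 4 * source γ κ s r
        = (γ - 1) / 4 * κ * ((γ + 1) / 4 * s * r + (3 - γ) / 8 * (r ^ 2 + s ^ 2)) := by
      rw [← hl]; unfold lam1 source; ring
    have : 0 ≤ (γ - 1) / 4 * κ * ((γ + 1) / 4 * s * r + (3 - γ) / 8 * (r ^ 2 + s ^ 2)) := by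
      have := hs.trans hr
      have : 0 ≤ (γ + 1) / 4 * s * r := by positivity
      have : 0 ≤ (3 - γ) / 8 * (r ^ 2 + s ^ 2) := mul_nonneg (by linarith) (by positivity)
      exact mul_nonneg (mul_nonneg (by linarith) hκ) (by linarith)
    linarith
  have e2 : η ≤ l * (η / m) := by
    rw [mul_div_assoc', le_div_iff₀ hm]; nlinarith
  have e3 : (3 - γ) / 4 * u ≤ η := by nlinarith
  have : l * ((3 - γ) / 4 * p) ≤ l * ((γ - 1) / 4 * κ * r + η / m) := by nlinarith
  exact le_of_mul_le_mul_left this hl0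

/-- Bound for the coefficient coupling the two difference quotients. -/
theorem abs_coupling_coefficient_le {γ κ s s₁ p B : ℝ} (h1 : 1 < γ) (h3 : γ < 3) (hκ : 0 ≤ κ)
    (hκB : κ ≤ B) (hs : 0 ≤ s) (hs₁ : 0 ≤ s₁) (hsB : s ≤ B) (hs₁B : s₁ ≤ B) (hp : |p| ≤ B) :
    |(γ - 1) / 8 * κ * (s + s₁) - (3 - γ) / 4 * p| ≤ B + B ^ 2 := by
  have hB : 0 ≤ B := hκ.trans hκB
  have e1 : |(γ - 1) / 8 * κ * (s + s₁)| ≤ B ^ 2 := by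
    rw [abs_of_nonneg (mul_nonneg (mul_nonneg (by linarith) hκ) (by linarith))]
    have hle : (γ - 1) / 8 * κ ≤ 1 / 2 * B :=
      mul_le_mul (by linarith) hκB hκ (by norm_num)
    have := mul_le_mul hle (add_le_add hsB hs₁B) (by linarith) (by linarith)
    linarith
  have e2 : |(3 - γ) / 4 * p| ≤ B := by
    rw [abs_mul, abs_of_nonneg (by linarith)]
    nlinarith [abs_nonneg p]
  linarith [abs_sub ((γ - 1) / 8 * κ * (s + s₁)) ((3 - γ) / 4 * p)]

/-- The right-hand side of the equation for the smaller difference quotient is bounded below. -/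
theorem lt_coupled_rhs {γ A P p D E B C η : ℝ} (h1 : 1 < γ) (h3 : γ < 3) (hη : 0 < η) (hC : 0 ≤ C)
    (hA : |A| ≤ B + B ^ 2) (hp : |p| ≤ B) (hP : 0 ≤ P) (hD : D < -η) (hDE : D ≤ E) (hE : E ≤ B)
    (hApos : 0 < E → -(C * η) ≤ A) :
    -- The first `B` absorbs the term in `p`, the bracket absorbs `A * E`, and the final `1` makes
    -- the inequality strict.
    (B + (B + B ^ 2 + C * (B + B ^ 2)) + 1) * D
      < A * E + P * (-D) + (γ + 1) / 4 * p * (-D) := by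
  have hB : 0 ≤ B := (abs_nonneg p).trans hp
  have hAE := neg_mul_le_mul_of_bounds (d := -D) hA (hE.trans (by linarith [sq_nonneg B]))
    (by linarith) (by linarith) hη hC hApos
  have h4 : 0 ≤ P * (-D) := mul_nonneg hP (by linarith)
  have h6 : -B ≤ (γ + 1) / 4 * p := by
    have : |(γ + 1) / 4 * p| ≤ B := by
      rw [abs_mul, abs_of_nonneg (by linarith)]
      nlinarith [abs_nonneg p]
    exact (abs_le.1 this).1
  have h5 := mul_le_mul_of_nonneg_right h6 (by linarith : 0 ≤ -D)
  linarith

/-- Lower bound for the transported time difference quotient of `S` where it is negative and below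
that of `R`. -/
theorem slow_quotient_lower_bound {γ κ s r s₁ r₁ D E p u η h m B : ℝ} (h1 : 1 < γ) (h3 : γ < 3)
    (hκ : 0 ≤ κ) (hκB : κ ≤ B) (hs : 0 < s) (hr : s < r) (hs₁ : 0 < s₁) (hr₁ : s₁ < r₁)
    (hrB : r ≤ B) (hr₁B : r₁ ≤ B)
    (hh : 0 < h) (hD : s - s₁ = h * D) (hE : r - r₁ = h * E) (hη : 0 < η) (hDη : D < -η)
    (hDE : D ≤ E) (hEB : E ≤ B) (hpB : |p| ≤ B) (hm : 0 < m) (hml : m ≤ lam1 γ s₁ r₁)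
    (hp : lam1 γ s₁ r₁ * p = source γ κ s₁ r₁ + u) (hu : u ≤ η) :
    (B + (B + B ^ 2 + 1 / m * (B + B ^ 2)) + 1) * D
      < h⁻¹ * (source γ κ s r - (source γ κ s₁ r₁ + (lam1 γ s r - lam1 γ s₁ r₁) * p)) := by
  have hB : 0 ≤ B := (abs_nonneg p).trans hpB
  set A := (γ - 1) / 8 * κ * (r + r₁) - (3 - γ) / 4 * p with hA
  have hV : h⁻¹ * (source γ κ s r - (source γ κ s₁ r₁ + (lam1 γ s r - lam1 γ s₁ r₁) * p))
      = A * E + (γ - 1) / 8 * κ * (s + s₁) * (-D) + (γ + 1) / 4 * p * (-D) := by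
    rw [inv_mul_eq_iff_eq_mul₀ hh.ne', hA]
    unfold source lam1
    linear_combination ((γ - 1) / 8 * κ * (r + r₁) - (3 - γ) / 4 * p) * hE
      - ((γ - 1) / 8 * κ * (s + s₁) + (γ + 1) / 4 * p) * hD
  -- If `E > 0` then `r > r₁`, so `r + r₁` may be replaced by `2 r₁`, and the bound on `p` at the
  -- later time applies.
  have hApos : 0 < E → -(1 / m * η) ≤ A := by
    intro hE0
    have := source_div_speed_le h1 h3 hκ hs₁ hr₁ hm hml rfl hp hη hu
    have hrr : r₁ ≤ r := by nlinarith
    have : (γ - 1) / 8 * κ * (r₁ + r₁) ≤ (γ - 1) / 8 * κ * (r + r₁) :=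
      mul_le_mul_of_nonneg_left (by linarith) (mul_nonneg (by linarith) hκ)
    have : 1 / m * η = η / m := by ring
    linarith
  rw [hV]
  exact lt_coupled_rhs h1 h3 hη (by positivity)
    (abs_coupling_coefficient_le h1 h3 hκ hκB (by linarith) (by linarith) hrB hr₁B hpB) hpB
    (mul_nonneg (mul_nonneg (by linarith) hκ) (by linarith)) hDη hDE hEB hApos

/-- Lower bound for the transported time difference quotient of `R` where it is negative and below
that of `S`. -/
theorem fast_quotient_lower_bound {γ κ s r s₁ r₁ D E q w η h m B : ℝ} (h1 : 1 < γ) (h3 : γ < 3)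
    (hκ : 0 ≤ κ) (hκB : κ ≤ B) (hs : 0 < s) (hr : s < r) (hs₁ : 0 < s₁) (hr₁ : s₁ < r₁)
    (hrB : r ≤ B) (hr₁B : r₁ ≤ B)
    (hh : 0 < h) (hD : s - s₁ = h * D) (hE : r - r₁ = h * E) (hη : 0 < η) (hEη : E < -η)
    (hED : E ≤ D) (hDB : D ≤ B) (hqB : |q| ≤ B) (hm : 0 < m) (hml : m ≤ lam2 γ s₁ r₁)
    (hq : lam2 γ s₁ r₁ * q = -source γ κ s₁ r₁ + w) (hw : w ≤ η) :
    (B + (B + B ^ 2 + 1 / m * (B + B ^ 2)) + 1) * E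
      < h⁻¹ * (-source γ κ s r - (-source γ κ s₁ r₁ + (lam2 γ s r - lam2 γ s₁ r₁) * q)) := by
  have hB : 0 ≤ B := (abs_nonneg q).trans hqB
  set A := (γ - 1) / 8 * κ * (s + s₁) - (3 - γ) / 4 * q with hA
  have hV : h⁻¹ * (-source γ κ s r - (-source γ κ s₁ r₁ + (lam2 γ s r - lam2 γ s₁ r₁) * q))
      = A * D + (γ - 1) / 8 * κ * (r + r₁) * (-E) + (γ + 1) / 4 * q * (-E) := by
    rw [inv_mul_eq_iff_eq_mul₀ hh.ne', hA]
    unfold source lam2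
    linear_combination ((γ - 1) / 8 * κ * (s + s₁) - (3 - γ) / 4 * q) * hD
      - ((γ - 1) / 8 * κ * (r + r₁) + (γ + 1) / 4 * q) * hE
  have hκs0 : 0 ≤ (γ - 1) / 8 * κ * (s + s₁) :=
    mul_nonneg (mul_nonneg (by linarith) hκ) (by linarith)
  have hg : 0 ≤ source γ κ s₁ r₁ := by
    unfold source
    exact mul_nonneg (mul_nonneg (by linarith) hκ) (by nlinarith)
  have hApos : 0 < D → -(1 / m * η) ≤ A := by
    intro _
    -- Both `-g` and `w` push `q` down: `λ₂ q ≤ η`, hence `q ≤ η / m`.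
    have : m * q ≤ η := by
      rcases le_or_gt q 0 with hq0 | hq0
      · nlinarith
      · nlinarith
    have hqm : q ≤ η / m := by rwa [le_div_iff₀ hm, mul_comm]
    have hηm : 0 < η / m := div_pos hη hm
    have : 1 / m * η = η / m := by ring
    have : (3 - γ) / 4 * q ≤ η / m := by nlinarith
    linarith
  rw [hV]
  exact lt_coupled_rhs h1 h3 hη (by positivity)
    (abs_coupling_coefficient_le h1 h3 hκ hκB hs.le hs₁.le (by linarith) (by linarith) hqB) hqB
    (mul_nonneg (mul_nonneg (by linarith) hκ) (by linarith)) hEη hED hDB hApos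

/-! ### Monotonicity in time -/

namespace IsRiemannFlow

variable {γ xB : ℝ} {I : Set ℝ} {k : ℝ → ℝ} {S R : ℝ × ℝ → ℝ} {S' R' : ℝ × ℝ → ℝ × ℝ →L[ℝ] ℝ}

/-- Forward time difference quotients are uniformly close to the time derivative. -/
theorem exists_quotient_close {I : Set ℝ} {f : ℝ × ℝ → ℝ} {f' : ℝ × ℝ → ℝ × ℝ →L[ℝ] ℝ} {x₀ L : ℝ}
    (hI : Icc x₀ L ⊆ I)
    (hf : ∀ z ∈ I ×ˢ Ici (0 : ℝ), HasFDerivWithinAt f (f' z) (I ×ˢ Ici 0) z)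
    (hf' : ContinuousOn f' (I ×ˢ Ici 0)) (T : ℝ) {η : ℝ} (hη : 0 < η) :
    ∃ r > 0, ∀ h, 0 < h → h < r → h ≤ 1 → ∀ x ∈ Icc x₀ L, ∀ t ∈ Icc 0 T,
      |h⁻¹ * (f (x, t) - f (x, t + h)) + f' (x, t) (0, 1)| ≤ η ∧
      |h⁻¹ * (f (x, t) - f (x, t + h)) + f' (x, t + h) (0, 1)| ≤ η ∧
      ∃ τ ∈ Icc 0 (T + 1), h⁻¹ * (f (x, t) - f (x, t + h)) = -f' (x, τ) (0, 1) := by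
  have hsub : Icc x₀ L ×ˢ Icc 0 (T + 1) ⊆ I ×ˢ Ici (0 : ℝ) := prod_mono hI Icc_subset_Ici_self
  have hc : ContinuousOn (fun z => f' z (0, 1)) (Icc x₀ L ×ˢ Icc 0 (T + 1)) :=
    (hf'.clm_apply continuousOn_const).mono hsub
  obtain ⟨r, hr, hclose⟩ := Metric.uniformContinuousOn_iff.1
    ((isCompact_rectangle x₀ L (T + 1)).uniformContinuousOn_of_continuous hc) η hη
  refine ⟨r, hr, fun h hh hhr hh1 x hx t ht => ?_⟩
  have hline : ∀ τ ∈ Icc t (t + h), HasDerivWithinAt (fun τ => f (x, τ)) (f' (x, τ) (0, 1))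
      (Icc t (t + h)) τ := by
    intro τ hτ
    have hmaps : MapsTo (fun τ : ℝ => (x, τ)) (Icc t (t + h)) (I ×ˢ Ici (0 : ℝ)) := fun σ hσ =>
      ⟨hI hx, ht.1.trans hσ.1⟩
    have := (hf (x, τ) (hmaps hτ)).comp_hasDerivWithinAt τ
      ((hasDerivWithinAt_const τ _ x).prodMk (hasDerivWithinAt_id τ _)) hmaps
    exact this
  -- By the mean value theorem the quotient is exactly a time derivative at an intermediate time,
  -- which gives both the uniform closeness and a bound independent of `h`.
  obtain ⟨τ, hτ, heq⟩ := exists_hasDerivAt_eq_slope (fun τ => f (x, τ))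
    (fun τ => f' (x, τ) (0, 1)) (by linarith : t < t + h)
    (fun τ hτ => (hline τ hτ).continuousWithinAt)
    (fun τ hτ => (hline τ (Ioo_subset_Icc_self hτ)).hasDerivAt (Icc_mem_nhds hτ.1 hτ.2))
  have hquot : h⁻¹ * (f (x, t) - f (x, t + h)) = -f' (x, τ) (0, 1) := by
    have heq' : f' (x, τ) (0, 1) = (f (x, t + h) - f (x, t)) / (t + h - t) := heq
    rw [heq', add_sub_cancel_left]
    ring
  have hmem : ∀ σ, t ≤ σ → σ ≤ t + h → (x, σ) ∈ Icc x₀ L ×ˢ Icc 0 (T + 1) := fun σ h1 h2 =>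
    ⟨hx, ht.1.trans h1, by linarith [ht.2]⟩
  have hd : ∀ σ, t ≤ σ → σ ≤ t + h → |-f' (x, τ) (0, 1) + f' (x, σ) (0, 1)| ≤ η := by
    intro σ h1 h2
    have := hclose (x, σ) (hmem σ h1 h2) (x, τ) (hmem τ hτ.1.le hτ.2.le) (by
      rw [dist_prod_same_left, Real.dist_eq]
      refine lt_of_le_of_lt ?_ hhr
      rw [abs_le]
      constructor <;> linarith [hτ.1, hτ.2])
    rw [Real.dist_eq] at this
    rw [neg_add_eq_sub]
    exact this.le
  rw [hquot]
  exact ⟨hd t le_rfl (by linarith), hd (t + h) (by linarith) le_rfl, τ,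
    (hmem τ hτ.1.le hτ.2.le).2, rfl⟩

theorem hasFDerivWithinAt_quotient {I : Set ℝ} {f : ℝ × ℝ → ℝ} {f' : ℝ × ℝ → ℝ × ℝ →L[ℝ] ℝ}
    {x₀ L T h : ℝ} (hI : Icc x₀ L ⊆ I) (hh : 0 ≤ h)
    (hf : ∀ z ∈ I ×ˢ Ici (0 : ℝ), HasFDerivWithinAt f (f' z) (I ×ˢ Ici 0) z)
    {z : ℝ × ℝ} (hz : z ∈ Icc x₀ L ×ˢ Icc 0 T) :
    HasFDerivWithinAt (fun z : ℝ × ℝ => h⁻¹ * (f z - f (z.1, z.2 + h)))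
      (h⁻¹ • (f' z - f' (z.1, z.2 + h))) (Icc x₀ L ×ˢ Icc 0 T) z := by
  have hsub : Icc x₀ L ×ˢ Icc 0 T ⊆ I ×ˢ Ici (0 : ℝ) := prod_mono hI Icc_subset_Ici_self
  have hmaps : MapsTo (fun z : ℝ × ℝ => (z.1, z.2 + h)) (Icc x₀ L ×ˢ Icc 0 T) (I ×ˢ Ici 0) :=
    fun y hy => ⟨hI hy.1, add_nonneg hy.2.1 hh⟩
  have hshift := (hf _ (hmaps hz)).comp z
    (hasFDerivWithinAt_fst.prodMk (hasFDerivWithinAt_snd.add_const h)) hmaps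
  have hshift' : HasFDerivWithinAt (fun z : ℝ × ℝ => f (z.1, z.2 + h)) (f' (z.1, z.2 + h))
      (Icc x₀ L ×ˢ Icc 0 T) z := by
    exact hshift.congr_fderiv (ContinuousLinearMap.ext fun v => rfl)
  exact (((hf z (hsub hz)).mono hsub).sub hshift').const_mul h⁻¹

/-- If `S` and `R` are nonincreasing in time at the initial time and on the left boundary, they
are nonincreasing in time everywhere. -/
theorem time_deriv_nonpos (h : IsRiemannFlow γ xB I k S R S' R')
    (hpos : ∀ z ∈ I ×ˢ Ici 0, 0 < S z ∧ S z < R z)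
    (hinit : ∀ x ∈ I, S' (x, 0) (0, 1) ≤ 0 ∧ R' (x, 0) (0, 1) ≤ 0)
    (hbd : ∀ t, 0 ≤ t → S' (xB, t) (0, 1) ≤ 0 ∧ R' (xB, t) (0, 1) ≤ 0) :
    ∀ z ∈ I ×ˢ Ici 0, S' z (0, 1) ≤ 0 ∧ R' z (0, 1) ≤ 0 := by
  rintro ⟨L, T⟩ ⟨hL, hT⟩
  simp only [mem_Ici] at hL hT
  have h1 := h.one_lt
  have h3 := h.lt_three
  have hxBL := h.left_le L hL
  have hI := h.Icc_subset L hL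
  have hsub := h.rectangle_subset hL T
  have hsub1 := h.rectangle_subset hL (T + 1)
  obtain ⟨B₁, hB₁⟩ := h.exists_bound (f := fun z => k z.1)
    (h.k_cont.comp continuousOn_fst fun z hz => hz.1) hL (T + 1)
  obtain ⟨B₂, hB₂⟩ := h.exists_bound h.R_cont hL (T + 1)
  obtain ⟨B₃, hB₃⟩ := h.exists_bound (h.S'_cont.clm_apply (continuousOn_const (c := (1, 0))))
    hL (T + 1)
  obtain ⟨B₄, hB₄⟩ := h.exists_bound (h.R'_cont.clm_apply (continuousOn_const (c := (1, 0))))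
    hL (T + 1)
  obtain ⟨B₅, hB₅⟩ := h.exists_bound (h.S'_cont.clm_apply (continuousOn_const (c := (0, 1))))
    hL (T + 1)
  obtain ⟨B₆, hB₆⟩ := h.exists_bound (h.R'_cont.clm_apply (continuousOn_const (c := (0, 1))))
    hL (T + 1)
  -- One bound for all coefficients, taken up to time `T + 1` to cover the shifted points. Neither
  -- `B` nor `K` depends on `η` or on the step `d`, so `η → 0` is possible at the end.
  obtain ⟨B, b₁, b₂, b₃, b₄, b₅, b₆⟩ : ∃ B, B₁ ≤ B ∧ B₂ ≤ B ∧ B₃ ≤ B ∧ B₄ ≤ B ∧ B₅ ≤ B ∧ B₆ ≤ B :=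
    ⟨max B₁ (max B₂ (max B₃ (max B₄ (max B₅ B₆)))), by simp⟩
  have hB : 0 ≤ B := (abs_nonneg _).trans
    ((hB₁ (L, T) ⟨⟨hxBL, le_rfl⟩, hT, by simp⟩).trans b₁)
  obtain ⟨y, hy, hymin⟩ := (isCompact_rectangle xB L (T + 1)).exists_isMinOn
    ⟨(L, T), ⟨hxBL, le_rfl⟩, hT, by simp⟩ (h.S_cont.mono hsub1)
  set m := S y with hm_def
  have hm : 0 < m := (hpos y (hsub1 hy)).1
  have hmS : ∀ z ∈ Icc xB L ×ˢ Icc 0 (T + 1), m ≤ S z := fun z hz => hymin hz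
  have hlam1 : ∀ z ∈ Icc xB L ×ˢ Icc 0 (T + 1), m ≤ lam1 γ (S z) (R z) := by
    intro z hz
    have := hmS z hz
    have := hpos z (hsub1 hz)
    unfold lam1
    nlinarith
  have hlam2 : ∀ z ∈ Icc xB L ×ˢ Icc 0 (T + 1), m ≤ lam2 γ (S z) (R z) := by
    intro z hz
    have := hmS z hz
    have := hpos z (hsub1 hz)
    unfold lam2
    nlinarith
  have hQ : ∀ z ∈ Icc xB L ×ˢ Icc 0 T, z ∈ Icc xB L ×ˢ Icc 0 (T + 1) := fun z hz =>
    ⟨hz.1, hz.2.1, by linarith [hz.2.2]⟩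
  set K := B + (B + B ^ 2 + 1 / m * (B + B ^ 2)) + 1 with hK_def
  have hK : 0 ≤ K := by positivity
  have key : ∀ η > 0, S' (L, T) (0, 1) ≤ η + η * Real.exp (K * T) ∧
      R' (L, T) (0, 1) ≤ η + η * Real.exp (K * T) := by
    intro η hη
    obtain ⟨r₁, hr₁, c₁⟩ := exists_quotient_close hI h.S_hasDeriv h.S'_cont T hη
    obtain ⟨r₂, hr₂, c₂⟩ := exists_quotient_close hI h.R_hasDeriv h.R'_cont T hη
    obtain ⟨d, hd, hd1, hd2, hd3⟩ : ∃ d : ℝ, 0 < d ∧ d < r₁ ∧ d < r₂ ∧ d ≤ 1 := by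
      have hr : 0 < min r₁ r₂ := lt_min hr₁ hr₂
      refine ⟨min (min r₁ r₂ / 2) 1, lt_min (by linarith) one_pos, ?_, ?_, min_le_right _ _⟩
      · exact (min_le_left _ _).trans_lt ((half_lt_self hr).trans_le (min_le_left _ _))
      · exact (min_le_left _ _).trans_lt ((half_lt_self hr).trans_le (min_le_right _ _))
    set D : ℝ × ℝ → ℝ := fun z => d⁻¹ * (S z - S (z.1, z.2 + d)) with hD
    set E : ℝ × ℝ → ℝ := fun z => d⁻¹ * (R z - R (z.1, z.2 + d)) with hE
    have q₁ : ∀ z ∈ Icc xB L ×ˢ Icc 0 T, |D z + S' z (0, 1)| ≤ η ∧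
        |D z + S' (z.1, z.2 + d) (0, 1)| ≤ η ∧
        ∃ τ ∈ Icc 0 (T + 1), D z = -S' (z.1, τ) (0, 1) := fun z hz =>
      c₁ d hd hd1 hd3 z.1 hz.1 z.2 hz.2
    have q₂ : ∀ z ∈ Icc xB L ×ˢ Icc 0 T, |E z + R' z (0, 1)| ≤ η ∧
        |E z + R' (z.1, z.2 + d) (0, 1)| ≤ η ∧
        ∃ τ ∈ Icc 0 (T + 1), E z = -R' (z.1, τ) (0, 1) := fun z hz =>
      c₂ d hd hd2 hd3 z.1 hz.1 z.2 hz.2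
    have hshift : ∀ z ∈ Icc xB L ×ˢ Icc 0 T, (z.1, z.2 + d) ∈ Icc xB L ×ˢ Icc 0 (T + 1) :=
      fun z hz => ⟨hz.1, add_nonneg hz.2.1 hd.le, by linarith [hz.2.2]⟩
    have low : ∀ z ∈ Icc xB L ×ˢ Icc 0 T, S' z (0, 1) ≤ 0 ∧ R' z (0, 1) ≤ 0 →
        -η ≤ D z ∧ -η ≤ E z := fun z hz hle =>
      ⟨by linarith [(abs_le.1 (q₁ z hz).1).1], by linarith [(abs_le.1 (q₂ z hz).1).1]⟩
    have main := coupled_transport_lower_bound (T := T) (D := D) (E := E)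
      (c := fun z => lam1 γ (S z) (R z)) (d := fun z => lam2 γ (S z) (R z)) hη hK
      (fun z hz => hasFDerivWithinAt_quotient hI hd.le h.S_hasDeriv hz)
      (fun z hz => hasFDerivWithinAt_quotient hI hd.le h.R_hasDeriv hz)
      (fun z hz => hm.le.trans (hlam1 z (hQ z hz))) (fun z hz => hm.le.trans (hlam2 z (hQ z hz)))
      (fun x hx => low _ ⟨hx, le_rfl, hT⟩ (hinit x (hI hx)))
      (fun t ht => low _ ⟨⟨le_rfl, hxBL⟩, ht⟩ (hbd t ht.1))
      (fun z hz hDη hDE => by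
        have hz1 := hshift z hz
        have hpz := hpos z (hsub hz)
        have hpz1 := hpos _ (hsub1 hz1)
        obtain ⟨τ, hτ, hEτ⟩ := (q₂ z hz).2.2
        have hpde := h.S_eq _ (hsub1 hz1)
        have hsp := clm_speed (S' (z.1, z.2 + d)) (lam1 γ (S (z.1, z.2 + d)) (R (z.1, z.2 + d)))
        have := slow_quotient_lower_bound (B := B) (m := m) (p := S' (z.1, z.2 + d) (1, 0))
          (u := -S' (z.1, z.2 + d) (0, 1)) (D := D z) (E := E z) h1 h3
          (h.k_nonneg z.1 (hI hz.1)) ((le_abs_self _).trans ((hB₁ _ hz1).trans b₁))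
          hpz.1 hpz.2 hpz1.1 hpz1.2 ((le_abs_self _).trans ((hB₂ _ (hQ z hz)).trans b₂))
          ((le_abs_self _).trans ((hB₂ _ hz1).trans b₂)) hd
          (by simp only [hD]; field_simp) (by simp only [hE]; field_simp) hη hDη hDE
          (by rw [hEτ]; exact (neg_le_abs _).trans ((hB₆ (z.1, τ) ⟨hz.1, hτ⟩).trans b₆))
          ((hB₃ _ hz1).trans b₃) hm (hlam1 _ hz1) (by rw [hpde] at hsp; linarith)
          (by linarith [(abs_le.1 (q₁ z hz).2.1).1])
        refine this.trans_eq ?_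
        -- The equation at the later point holds with the speed of that point; changing to the speed
        -- at `z` produces the term `(λ₁(z) - λ₁(z + (0, d))) S_x`.
        rw [smul_apply, sub_apply, smul_eq_mul, h.S_eq z (hsub hz),
          clm_change_speed (S' (z.1, z.2 + d)) _ (lam1 γ (S (z.1, z.2 + d)) (R (z.1, z.2 + d))),
          hpde])
      (fun z hz hEη hED => by
        have hz1 := hshift z hz
        have hpz := hpos z (hsub hz)
        have hpz1 := hpos _ (hsub1 hz1)
        obtain ⟨τ, hτ, hDτ⟩ := (q₁ z hz).2.2
        have hpde := h.R_eq _ (hsub1 hz1)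
        have hsp := clm_speed (R' (z.1, z.2 + d)) (lam2 γ (S (z.1, z.2 + d)) (R (z.1, z.2 + d)))
        have := fast_quotient_lower_bound (B := B) (m := m) (q := R' (z.1, z.2 + d) (1, 0))
          (w := -R' (z.1, z.2 + d) (0, 1)) (D := D z) (E := E z) h1 h3
          (h.k_nonneg z.1 (hI hz.1)) ((le_abs_self _).trans ((hB₁ _ hz1).trans b₁))
          hpz.1 hpz.2 hpz1.1 hpz1.2 ((le_abs_self _).trans ((hB₂ _ (hQ z hz)).trans b₂))
          ((le_abs_self _).trans ((hB₂ _ hz1).trans b₂)) hd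
          (by simp only [hD]; field_simp) (by simp only [hE]; field_simp) hη hEη hED
          (by rw [hDτ]; exact (neg_le_abs _).trans ((hB₅ (z.1, τ) ⟨hz.1, hτ⟩).trans b₅))
          ((hB₄ _ hz1).trans b₄) hm (hlam2 _ hz1) (by rw [hpde] at hsp; linarith)
          (by linarith [(abs_le.1 (q₂ z hz).2.1).1])
        refine this.trans_eq ?_
        rw [smul_apply, sub_apply, smul_eq_mul, h.R_eq z (hsub hz),
          clm_change_speed (R' (z.1, z.2 + d)) _ (lam2 γ (S (z.1, z.2 + d)) (R (z.1, z.2 + d))),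
          hpde])
    have hLT : (L, T) ∈ Icc xB L ×ˢ Icc 0 T := ⟨⟨hxBL, le_rfl⟩, hT, le_rfl⟩
    obtain ⟨m1, m2⟩ := main (L, T) hLT
    have n1 := abs_le.1 (q₁ _ hLT).1
    have n2 := abs_le.1 (q₂ _ hLT).1
    exact ⟨by linarith [n1.2], by linarith [n2.2]⟩
  have hlim : Tendsto (fun η : ℝ => η + η * Real.exp (K * T)) (𝓝[>] 0) (𝓝 0) := by
    have : Continuous fun η : ℝ => η + η * Real.exp (K * T) := by fun_prop
    simpa using (this.tendsto 0).mono_left nhdsWithin_le_nhds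
  exact ⟨ge_of_tendsto hlim (eventually_mem_nhdsWithin.mono fun η hη => (key η hη).1),
    ge_of_tendsto hlim (eventually_mem_nhdsWithin.mono fun η hη => (key η hη).2)⟩

end IsRiemannFlow

/-! ### From classical solutions to Riemann flows up to the boundary -/

theorem IsSpaceInterval.uniqueDiffOn {xB : ℝ} {I : Set ℝ} (hI : IsSpaceInterval xB I) :
    UniqueDiffOn ℝ I := by
  rcases hI with rfl | ⟨xC, h, rfl⟩
  exacts [uniqueDiffOn_Ici _, uniqueDiffOn_Icc h]

theorem IsSpaceInterval.subset_closure_interior {xB : ℝ} {I : Set ℝ} (hI : IsSpaceInterval xB I) :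
    I ⊆ closure (interior I) := by
  rcases hI with rfl | ⟨xC, h, rfl⟩
  · rw [interior_Ici, closure_Ioi]
  · rw [interior_Icc, closure_Ioo h.ne]

theorem IsSpaceInterval.left_mem {xB : ℝ} {I : Set ℝ} (hI : IsSpaceInterval xB I) : xB ∈ I := by
  rcases hI with rfl | ⟨xC, h, rfl⟩
  exacts [self_mem_Ici, left_mem_Icc.2 h.le]

theorem IsSpaceInterval.left_le {xB : ℝ} {I : Set ℝ} (hI : IsSpaceInterval xB I) :
    ∀ x ∈ I, xB ≤ x := by
  rcases hI with rfl | ⟨xC, h, rfl⟩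
  exacts [fun x hx => hx, fun x hx => hx.1]

theorem IsSpaceInterval.Icc_subset {xB : ℝ} {I : Set ℝ} (hI : IsSpaceInterval xB I) :
    ∀ x ∈ I, Icc xB x ⊆ I := by
  rcases hI with rfl | ⟨xC, h, rfl⟩
  exacts [fun x _ => Icc_subset_Ici_self, fun x hx => Icc_subset_Icc_right hx.2]

/-- A differential relation between slice derivatives in the open quarter-strip extends to total
derivatives up to the boundary. -/
theorem transport_eq_up_to_boundary {xB : ℝ} {I : Set ℝ} (hI : IsSpaceInterval xB I)
    {F : ℝ → ℝ → ℝ} {c g : ℝ × ℝ → ℝ}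
    (hF : ContDiffOn ℝ 1 (fun p : ℝ × ℝ => F p.1 p.2) (I ×ˢ Ici 0))
    (hc : ContinuousOn c (I ×ˢ Ici 0)) (hg : ContinuousOn g (I ×ˢ Ici 0))
    (heq : ∀ x ∈ interior I, ∀ t, 0 < t →
      deriv (fun τ => F x τ) t + c (x, t) * deriv (fun y => F y t) x = g (x, t)) :
    ∀ z ∈ I ×ˢ Ici 0,
      fderivWithin ℝ (fun p : ℝ × ℝ => F p.1 p.2) (I ×ˢ Ici 0) z (c z, 1) = g z := by
  have hu : UniqueDiffOn ℝ (I ×ˢ Ici (0 : ℝ)) := hI.uniqueDiffOn.prod (uniqueDiffOn_Ici 0)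
  have hcont := hF.continuousOn_fderivWithin hu le_rfl
  -- Both sides are continuous up to the boundary and agree on the dense open part.
  refine EqOn.of_subset_closure (s := interior I ×ˢ Ioi (0 : ℝ)) ?_
    (hcont.clm_apply (hc.prodMk continuousOn_const)) hg
    (prod_mono interior_subset Ioi_subset_Ici_self) ?_
  · rintro ⟨x, t⟩ ⟨hx, ht⟩
    have hnhds : I ×ˢ Ici (0 : ℝ) ∈ 𝓝 (x, t) :=
      prod_mem_nhds (mem_interior_iff_mem_nhds.1 hx) (Ici_mem_nhds ht)
    have hd : HasFDerivAt (fun p : ℝ × ℝ => F p.1 p.2)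
        (fderivWithin ℝ (fun p : ℝ × ℝ => F p.1 p.2) (I ×ˢ Ici 0) (x, t)) (x, t) :=
      ((hF.differentiableOn one_ne_zero _
        (mem_of_mem_nhds hnhds)).hasFDerivWithinAt).hasFDerivAt hnhds
    have ht' : HasDerivAt (fun τ => F x τ) _ t :=
      hd.comp_hasDerivAt t ((hasDerivAt_const t x).prodMk (hasDerivAt_id t))
    have hx' : HasDerivAt (fun y => F y t) _ x :=
      hd.comp_hasDerivAt (f := fun y => (y, t)) x ((hasDerivAt_id x).prodMk (hasDerivAt_const x t))
    have := heq x hx t ht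
    rw [ht'.deriv, hx'.deriv] at this
    show fderivWithin ℝ (fun p : ℝ × ℝ => F p.1 p.2) (I ×ˢ Ici 0) (x, t) (c (x, t), 1) = g (x, t)
    rw [clm_speed]
    exact this
  · rw [closure_prod_eq, closure_Ioi]
    exact prod_mono hI.subset_closure_interior subset_rfl

theorem IsGlobalC1Solution.isRiemannFlow {γ xB : ℝ} {I : Set ℝ} {k S₀ R₀ SB RB : ℝ → ℝ}
    {S R : ℝ → ℝ → ℝ} (h : IsGlobalC1Solution γ xB I k S₀ R₀ SB RB S R) (h1 : 1 < γ) (h3 : γ < 3)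
    (hI : IsSpaceInterval xB I) (hk : ContinuousOn k I) (hk0 : ∀ x ∈ I, 0 ≤ k x) :
    IsRiemannFlow γ xB I k (fun p => S p.1 p.2) (fun p => R p.1 p.2)
      (fderivWithin ℝ (fun p : ℝ × ℝ => S p.1 p.2) (I ×ˢ Ici 0))
      (fderivWithin ℝ (fun p : ℝ × ℝ => R p.1 p.2) (I ×ˢ Ici 0)) := by
  have hu : UniqueDiffOn ℝ (I ×ˢ Ici (0 : ℝ)) := hI.uniqueDiffOn.prod (uniqueDiffOn_Ici 0)
  have hS := h.S_C1.continuousOn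
  have hR := h.R_C1.continuousOn
  have hsrc : ContinuousOn (fun p : ℝ × ℝ => source γ (k p.1) (S p.1 p.2) (R p.1 p.2))
      (I ×ˢ Ici 0) :=
    (continuousOn_const.mul (hk.comp continuousOn_fst fun z hz => hz.1)).mul
      ((hR.pow 2).sub (hS.pow 2))
  exact
    { one_lt := h1
      lt_three := h3
      left_le := hI.left_le
      Icc_subset := hI.Icc_subset
      k_nonneg := hk0
      k_cont := hk
      S_hasDeriv := fun z hz => (h.S_C1.differentiableOn one_ne_zero z hz).hasFDerivWithinAt
      R_hasDeriv := fun z hz => (h.R_C1.differentiableOn one_ne_zero z hz).hasFDerivWithinAt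
      S'_cont := h.S_C1.continuousOn_fderivWithin hu le_rfl
      R'_cont := h.R_C1.continuousOn_fderivWithin hu le_rfl
      S_eq := transport_eq_up_to_boundary hI h.S_C1
        ((continuousOn_const.mul hS).add (continuousOn_const.mul hR)) hsrc h.S_eq
      R_eq := transport_eq_up_to_boundary hI h.R_C1
        ((continuousOn_const.mul hS).add (continuousOn_const.mul hR)) hsrc.neg h.R_eq }

theorem clm_apply_one_zero_eq_derivWithin {I : Set ℝ} {f : ℝ × ℝ → ℝ} {f' : ℝ × ℝ →L[ℝ] ℝ}
    {f₀ : ℝ → ℝ} {x : ℝ} (hI : UniqueDiffOn ℝ I) (hx : x ∈ I)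
    (hf : HasFDerivWithinAt f f' (I ×ˢ Ici 0) (x, 0)) (h0 : ∀ y ∈ I, f (y, 0) = f₀ y) :
    f' (1, 0) = derivWithin f₀ I x := by
  have h := hf.comp_hasDerivWithinAt (f := fun y => (y, (0 : ℝ))) x
    ((hasDerivWithinAt_id x I).prodMk (hasDerivWithinAt_const x I (0 : ℝ)))
    fun y hy => ⟨hy, le_refl (0 : ℝ)⟩
  exact ((h.congr (fun y hy => (h0 y hy).symm) (h0 x hx).symm).derivWithin (hI x hx)).symm

theorem clm_apply_zero_one_eq_derivWithin {I : Set ℝ} {f : ℝ × ℝ → ℝ} {f' : ℝ × ℝ →L[ℝ] ℝ}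
    {fB : ℝ → ℝ} {xB t : ℝ} (hxB : xB ∈ I) (ht : 0 ≤ t)
    (hf : HasFDerivWithinAt f f' (I ×ˢ Ici 0) (xB, t)) (hB : ∀ τ, 0 ≤ τ → f (xB, τ) = fB τ) :
    f' (0, 1) = derivWithin fB (Ici 0) t := by
  have h := hf.comp_hasDerivWithinAt t
    ((hasDerivWithinAt_const t (Ici (0 : ℝ)) xB).prodMk (hasDerivWithinAt_id t (Ici 0)))
    fun τ hτ => ⟨hxB, hτ⟩
  exact ((h.congr (fun τ hτ => (hB τ hτ).symm) (hB t ht).symm).derivWithin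
    (uniqueDiffOn_Ici 0 t ht)).symm

/-! ### Sign of `S_t` at the initial time -/

theorem bExp_neg {γ : ℝ} (h1 : 1 < γ) (h3 : γ < 3) : bExp γ < 0 := by
  unfold bExp
  exact div_neg_of_neg_of_pos (by linarith) (by linarith)

theorem xi_pos {s r : ℝ} (hs : 0 < s) (hr : s < r) : 0 < xi s r := by
  unfold xi
  rw [sub_pos, one_lt_div hs]
  exact hr

theorem mul_xi {s r : ℝ} (hs : 0 < s) : s * xi s r = r - s := by
  unfold xi
  field_simp

/-- This merges the cases `b ≠ -1` and `b = -1`: the leading coefficient `-1/b` is positive in both.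
In the logarithmic case `s ξ = r - s < M`, so the logarithm is bounded above, which is the only side
needed. -/
theorem InitialSlope.exists_affine_lower_bound {γ : ℝ} (h1 : 1 < γ) (h3 : γ < 3) (M : ℝ) :
    ∃ β > 0, ∃ A ≥ 0, ∀ κ s r ds dr : ℝ, 0 ≤ κ → 0 < s → s < r → r ≤ M →
      InitialSlope γ κ s r ds dr → κ * s / 2 * (β - A * xi s r) ≤ ds := by
  by_cases hb : bExp γ = -1
  · refine ⟨1, one_pos, |M|, abs_nonneg M, fun κ s r ds dr hκ hs hr hM h => ?_⟩
    refine le_trans (mul_le_mul_of_nonneg_left ?_ (by positivity)) (h.S_of_eq hb)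
    have hξ := xi_pos hs hr
    have hlog : Real.log (s * xi s r) ≤ |M| := by
      have := Real.log_le_sub_one_of_pos (mul_pos hs hξ)
      rw [mul_xi hs] at this ⊢
      linarith [le_abs_self M]
    linarith [mul_le_mul_of_nonneg_right hlog hξ.le]
  · refine ⟨1 / -bExp γ, one_div_pos.2 (by linarith [bExp_neg h1 h3]), |1 / (bExp γ + 1)|,
      abs_nonneg _, fun κ s r ds dr hκ hs hr hM h => ?_⟩
    refine le_trans (mul_le_mul_of_nonneg_left ?_ (by positivity)) (h.S_of_ne hb)
    linarith [mul_le_mul_of_nonneg_right (le_abs_self (1 / (bExp γ + 1))) (xi_pos hs hr).le]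

/-- For `ξ₀` small the initial slope condition makes `S_t` nonpositive initially. -/
theorem InitialSlope.exists_source_le {γ : ℝ} (h1 : 1 < γ) (h3 : γ < 3) (M : ℝ) :
    ∃ ξ₁ > 0, ∀ κ s r ds dr : ℝ, 0 ≤ κ → 0 < s → s < r → r ≤ M → xi s r ≤ ξ₁ → 0 ≤ ds →
      InitialSlope γ κ s r ds dr → source γ κ s r ≤ lam1 γ s r * ds := by
  obtain ⟨β, hβ, A, hA, hbound⟩ := exists_affine_lower_bound h1 h3 M
  -- For `ξ ≤ 1`, `(γ-1)/4 ξ (2 + ξ) ≤ 3ξ/2`, and this is at most `β - A ξ` exactly when `ξ (A +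
  -- 3/2) ≤ β`.
  refine ⟨min 1 (β / (A + 3 / 2)), lt_min one_pos (by positivity),
    fun κ s r ds dr hκ hs hr hM hξ hds h => ?_⟩
  have hlow := hbound κ s r ds dr hκ hs hr hM h
  have hξ0 := xi_pos hs hr
  have hr_eq : r = s + s * xi s r := by rw [mul_xi hs]; ring
  set ξ := xi s r
  have hξ1 : ξ ≤ 1 := hξ.trans (min_le_left _ _)
  have hξ2 : ξ * (A + 3 / 2) ≤ β := by
    rw [← le_div_iff₀ (by positivity)]
    exact hξ.trans (min_le_right _ _)
  have hsrc : source γ κ s r = κ * s / 2 * s * ((γ - 1) / 4 * (ξ * (2 + ξ))) := by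
    unfold source
    rw [hr_eq]
    ring
  have e1 : (γ - 1) / 4 * (ξ * (2 + ξ)) ≤ β - A * ξ := by
    have h4 : ξ * (2 + ξ) ≤ ξ * 3 := by gcongr; linarith
    have h5 : (γ - 1) / 4 * (ξ * (2 + ξ)) ≤ 1 / 2 * (ξ * 3) :=
      mul_le_mul (by linarith) h4 (by positivity) (by norm_num)
    linarith
  have e2 : s ≤ lam1 γ s r := by
    unfold lam1
    nlinarith
  calc source γ κ s r ≤ κ * s / 2 * s * (β - A * ξ) := by
        rw [hsrc]
        gcongr
    _ = s * (κ * s / 2 * (β - A * ξ)) := by ring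
    _ ≤ s * ds := by gcongr
    _ ≤ lam1 γ s r * ds := by gcongr

/-! ### Limits of `ρ` and `ξ`, and signs along characteristics -/

theorem density_tendsto_zero_iff {γ ν : ℝ} (h1 : 1 < γ) (hν : 0 < ν) {ι : Type*} {l : Filter ι}
    {s r : ι → ℝ} (hsr : ∀ i, s i ≤ r i) :
    Tendsto (fun i => density γ ν (s i) (r i)) l (𝓝 0) ↔
      Tendsto (fun i => r i - s i) l (𝓝 0) := by
  set e := 2 / (γ - 1) with he_def
  have he : 0 < e := div_pos two_pos (by linarith)
  set c := ((γ - 1) / (16 * ν)) ^ (1 / (γ - 1)) with hc_def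
  have hc : 0 < c := Real.rpow_pos_of_pos (div_pos (by linarith) (by linarith)) _
  constructor
  · intro h
    have h2 := ((h.const_mul c⁻¹).rpow_const (p := e⁻¹) (Or.inr (inv_pos.2 he).le))
    rw [mul_zero, Real.zero_rpow (inv_pos.2 he).ne'] at h2
    refine h2.congr fun i => ?_
    show (c⁻¹ * (c * (r i - s i) ^ e)) ^ e⁻¹ = r i - s i
    rw [inv_mul_cancel_left₀ hc.ne', Real.rpow_rpow_inv (sub_nonneg.2 (hsr i)) he.ne']
  · intro h
    have h2 := (h.rpow_const (p := e) (Or.inr he.le)).const_mul c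
    rwa [Real.zero_rpow he.ne', mul_zero] at h2

/-- Since `s ξ = r - s` with `m ≤ s ≤ B`, the two quantities are comparable up to constant factors.
-/
theorem xi_tendsto_zero_iff {ι : Type*} {l : Filter ι} {s r : ι → ℝ} {m B : ℝ} (hm : 0 < m)
    (hs : ∀ᶠ i in l, m ≤ s i) (hsr : ∀ᶠ i in l, s i ≤ r i) (hr : ∀ᶠ i in l, r i ≤ B) :
    Tendsto (fun i => xi (s i) (r i)) l (𝓝 0) ↔ Tendsto (fun i => r i - s i) l (𝓝 0) := by
  have hxi : ∀ᶠ i in l, 0 ≤ xi (s i) (r i) := by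
    filter_upwards [hs, hsr] with i h1 h2
    unfold xi
    rw [sub_nonneg, one_le_div (hm.trans_le h1)]
    exact h2
  constructor
  · intro h
    refine squeeze_zero' (hsr.mono fun i hi => sub_nonneg.2 hi) ?_ (by simpa using h.const_mul B)
    filter_upwards [hs, hsr, hr, hxi] with i h1 h2 h3 h4
    rw [← mul_xi (hm.trans_le h1)]
    gcongr
    linarith
  · intro h
    refine squeeze_zero' hxi ?_ (by simpa using h.const_mul m⁻¹)
    filter_upwards [hs, hsr, hr, hxi] with i h1 h2 h3 h4
    rw [← mul_xi (hm.trans_le h1), inv_mul_eq_div, le_div_iff₀ hm, mul_comm]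
    gcongr

/-- Along both families of characteristics `S` does not decrease and `R` does not increase when
the time derivatives of `S` and `R` are nonpositive. -/
theorem IsRiemannFlow.charSpeed_deriv_sign {γ xB : ℝ} {I : Set ℝ} {k : ℝ → ℝ} {S R : ℝ × ℝ → ℝ}
    {S' R' : ℝ × ℝ → ℝ × ℝ →L[ℝ] ℝ} (h : IsRiemannFlow γ xB I k S R S' R') {z : ℝ × ℝ}
    (hz : z ∈ I ×ˢ Ici (0 : ℝ)) (hpos : 0 < S z ∧ S z < R z)
    (ht : S' z (0, 1) ≤ 0 ∧ R' z (0, 1) ≤ 0) (i : Fin 2) :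
    0 ≤ S' z (charSpeed γ i (S z) (R z), 1) ∧ R' z (charSpeed γ i (S z) (R z), 1) ≤ 0 := by
  have h1 := h.one_lt
  have h3 := h.lt_three
  obtain ⟨hs, hr⟩ := hpos
  have hl1 : 0 < lam1 γ (S z) (R z) := by unfold lam1; nlinarith
  have hl : lam1 γ (S z) (R z) ≤ lam2 γ (S z) (R z) := by unfold lam1 lam2; nlinarith
  have hl2 := hl1.trans_le hl
  have hg : 0 ≤ source γ (k z.1) (S z) (R z) := by
    unfold source
    exact mul_nonneg (mul_nonneg (by linarith) (h.k_nonneg _ hz.1)) (by nlinarith)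
  have eS := h.S_eq z hz
  have eR := h.R_eq z hz
  have cS := clm_speed (S' z) (lam1 γ (S z) (R z))
  have cR := clm_speed (R' z) (lam2 γ (S z) (R z))
  fin_cases i
  · refine ⟨?_, ?_⟩
    · show 0 ≤ S' z (lam1 γ (S z) (R z), 1)
      rw [eS]; exact hg
    · show R' z (lam1 γ (S z) (R z), 1) ≤ 0
      rw [clm_speed]
      -- Eliminating `R_x` turns the product into `(λ₂ - λ₁) R_t - λ₁ g`.
      have : lam2 γ (S z) (R z) * (R' z (0, 1) + lam1 γ (S z) (R z) * R' z (1, 0)) ≤ 0 := by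
        nlinarith
      exact nonpos_of_mul_nonpos_right this hl2
  · refine ⟨?_, ?_⟩
    · show 0 ≤ S' z (lam2 γ (S z) (R z), 1)
      rw [clm_speed]
      have : 0 ≤ lam1 γ (S z) (R z) * (S' z (0, 1) + lam2 γ (S z) (R z) * S' z (1, 0)) := by
        nlinarith
      exact nonneg_of_mul_nonneg_right this hl1
    · show R' z (lam2 γ (S z) (R z), 1) ≤ 0
      rw [eR]; linarith

theorem IsCharacteristic.hasDerivWithinAt {γ : ℝ} {I : Set ℝ} {S R : ℝ → ℝ → ℝ} {i : Fin 2}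
    {J : Set ℝ} {X : ℝ → ℝ} (hX : IsCharacteristic γ I S R i J X) {F : ℝ → ℝ → ℝ}
    {F' : ℝ × ℝ → ℝ × ℝ →L[ℝ] ℝ}
    (hF : ∀ z ∈ I ×ˢ Ici 0, HasFDerivWithinAt (fun p : ℝ × ℝ => F p.1 p.2) (F' z) (I ×ˢ Ici 0) z)
    {t : ℝ} (ht : t ∈ J) :
    HasDerivWithinAt (fun t => F (X t) t)
      (F' (X t, t) (charSpeed γ i (S (X t) t) (R (X t) t), 1)) J t :=
  (hF (X t, t) ⟨hX.mem t ht, hX.time_nonneg t ht⟩).comp_hasDerivWithinAt (f := fun t => (X t, t)) t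
    ((hX.ode t ht).prodMk (hasDerivWithinAt_id t J)) fun τ hτ => ⟨hX.mem τ hτ, hX.time_nonneg τ hτ⟩

end DuctFlow

/-! ### Assembly -/

theorem proposition3p4 (γ : ℝ) (hγ1 : 1 < γ) (hγ3 : γ < 3)
    (xB : ℝ) (I : Set ℝ) (hI : DuctFlow.IsSpaceInterval xB I)
    (a : ℝ → ℝ) (ha : DuctFlow.IsDivergentDuct I a)
    (hk : DuctFlow.HasBoundedC1 I (DuctFlow.ductK I a))
    (δ : ℝ) (hδ0 : 0 < δ) (hδ2 : δ < 2)
    (hk' : ∀ x ∈ I, derivWithin (DuctFlow.ductK I a) I x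
      ≤ DuctFlow.ductK I a x ^ 2 / ((2 - δ) * DuctFlow.bExp γ))
    (C M : ℝ) :
    ∃ νs : ℝ, 0 < νs ∧ ∀ ν : ℝ, 0 < ν → ν ≤ νs →
      ∀ S₀ R₀ SB RB : ℝ → ℝ,
        DuctFlow.AdmissibleData γ xB I (DuctFlow.ductK I a) C M ν S₀ R₀ SB RB →
      ∀ S R : ℝ → ℝ → ℝ,
        DuctFlow.IsGlobalC1Solution γ xB I (DuctFlow.ductK I a) S₀ R₀ SB RB S R →
      ∀ (i : Fin 2) (J : Set ℝ) (X : ℝ → ℝ), DuctFlow.IsCharacteristic γ I S R i J X →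
        MonotoneOn (fun t => S (X t) t) J ∧
        AntitoneOn (fun t => R (X t) t) J ∧
        AntitoneOn (fun t => DuctFlow.xi (S (X t) t) (R (X t) t)) J ∧
        (Tendsto (fun t : J => DuctFlow.xi (S (X t) t) (R (X t) t)) atTop (𝓝 0) ↔
          Tendsto (fun t : J => DuctFlow.density γ ν (S (X t) t) (R (X t) t)) atTop (𝓝 0)) := by
  open DuctFlow in
  have hk0 : ∀ x ∈ I, 0 ≤ ductK I a x := fun x hx =>
    div_nonneg (ha.deriv_nonneg x hx) (ha.pos x hx).le
  obtain ⟨ξ₁, hξ₁, hsource⟩ := InitialSlope.exists_source_le hγ1 hγ3 M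
  -- Chosen so that `C √ν ≤ ξ₁`; the `+ 1` avoids division by zero when `C = 0`.
  refine ⟨(ξ₁ / (|C| + 1)) ^ 2, by positivity, ?_⟩
  intro ν hν hνs S₀ R₀ SB RB hdata S R hsol i J X hX
  have hξν : C * √ν ≤ ξ₁ := by
    have h1 : √ν ≤ ξ₁ / (|C| + 1) := Real.sqrt_le_iff.2 ⟨by positivity, hνs⟩
    rw [le_div_iff₀ (by positivity)] at h1
    nlinarith [le_abs_self C, Real.sqrt_nonneg ν]
  have hflow := hsol.isRiemannFlow hγ1 hγ3 hI hk.1.continuousOn hk0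
  have hpos := hflow.pos
    (fun x hx => by
      show 0 < S x 0 ∧ S x 0 < R x 0
      rw [hsol.S_init x hx, hsol.R_init x hx]
      exact hdata.init_pos x hx)
    (fun t ht => by
      show 0 < S xB t ∧ S xB t < R xB t
      rw [hsol.S_bdry t ht, hsol.R_bdry t ht]
      exact hdata.bdry_pos t ht)
  have htime := hflow.time_deriv_nonpos hpos
    (fun x hx => by
      have hmem : (x, (0 : ℝ)) ∈ I ×ˢ Ici (0 : ℝ) := ⟨hx, le_refl (0 : ℝ)⟩
      obtain ⟨hs, hr⟩ := hdata.init_pos x hx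
      have eS := hflow.S_eq _ hmem
      have eR := hflow.R_eq _ hmem
      have dS := clm_apply_one_zero_eq_derivWithin hI.uniqueDiffOn hx
        (hflow.S_hasDeriv _ hmem) hsol.S_init
      have dR := clm_apply_one_zero_eq_derivWithin hI.uniqueDiffOn hx
        (hflow.R_hasDeriv _ hmem) hsol.R_init
      simp only [clm_speed _ (lam1 _ _ _), clm_speed _ (lam2 _ _ _), hsol.S_init x hx,
        hsol.R_init x hx, dS, dR] at eS eR
      have hle := hsource _ _ _ _ _ (hk0 x hx) hs hr (hdata.init_le x hx)
        ((hdata.init_xi x hx).trans hξν) (hdata.init_mono x hx).1 (hdata.init_slope x hx)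
      -- For `R` the sign is immediate: `R_t = -g - λ₂ R₀'` with both terms nonpositive.
      have hg : 0 ≤ source γ (ductK I a x) (S₀ x) (R₀ x) := by
        unfold source
        exact mul_nonneg (mul_nonneg (by linarith) (hk0 x hx)) (by nlinarith)
      have hl2 : 0 ≤ lam2 γ (S₀ x) (R₀ x) := by
        unfold lam2
        nlinarith
      have hR := mul_nonneg hl2 (hdata.init_mono x hx).2
      exact ⟨by linarith, by linarith⟩)
    (fun t ht => by
      have hmem : (xB, t) ∈ I ×ˢ Ici (0 : ℝ) := ⟨hI.left_mem, ht⟩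
      rw [clm_apply_zero_one_eq_derivWithin hI.left_mem ht (hflow.S_hasDeriv _ hmem) hsol.S_bdry,
        clm_apply_zero_one_eq_derivWithin hI.left_mem ht (hflow.R_hasDeriv _ hmem) hsol.R_bdry]
      exact hdata.bdry_mono t ht)
  have hmem : ∀ t ∈ J, (X t, t) ∈ I ×ˢ Ici (0 : ℝ) := fun t ht => ⟨hX.mem t ht, hX.time_nonneg t ht⟩
  have hposX : ∀ t ∈ J, 0 < S (X t) t ∧ S (X t) t < R (X t) t := fun t ht => hpos _ (hmem t ht)
  have hsign := fun t (ht : t ∈ J) =>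
    hflow.charSpeed_deriv_sign (hmem t ht) (hpos _ (hmem t ht)) (htime _ (hmem t ht)) i
  have hS : MonotoneOn (fun t => S (X t) t) J :=
    monotoneOn_of_hasDerivWithinAt_nonneg hX.interval.convex
      (fun t ht => (hX.hasDerivWithinAt hflow.S_hasDeriv ht).continuousWithinAt)
      (fun t ht => (hX.hasDerivWithinAt hflow.S_hasDeriv (interior_subset ht)).mono interior_subset)
      (fun t ht => (hsign t (interior_subset ht)).1)
  have hR : AntitoneOn (fun t => R (X t) t) J :=
    antitoneOn_of_hasDerivWithinAt_nonpos hX.interval.convex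
      (fun t ht => (hX.hasDerivWithinAt hflow.R_hasDeriv ht).continuousWithinAt)
      (fun t ht => (hX.hasDerivWithinAt hflow.R_hasDeriv (interior_subset ht)).mono interior_subset)
      (fun t ht => (hsign t (interior_subset ht)).2)
  refine ⟨hS, hR, fun t₁ ht₁ t₂ ht₂ h12 => ?_, ?_⟩
  · have p1 := hposX t₁ ht₁
    have p2 := hposX t₂ ht₂
    exact sub_le_sub_right (div_le_div₀ (p1.1.trans p1.2).le (hR ht₁ ht₂ h12) p1.1
      (hS ht₁ ht₂ h12)) 1
  · rcases isEmpty_or_nonempty J with hJ | ⟨⟨t₀, ht₀⟩⟩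
    -- On an empty interval the filter is trivial and both limits hold vacuously.
    · simp [filter_eq_bot_of_isEmpty (atTop : Filter J)]
    · have hev : ∀ᶠ t : J in atTop, (⟨t₀, ht₀⟩ : J) ≤ t := eventually_ge_atTop _
      -- After any time `t₀` of `J`, monotonicity supplies the bounds `S ≥ S(t₀) > 0` and `R ≤
      -- R(t₀)` that make `ξ` comparable with `R - S`.
      rw [density_tendsto_zero_iff hγ1 hν fun t : J => (hposX t t.2).2.le]
      exact xi_tendsto_zero_iff (hposX t₀ ht₀).1 (hev.mono fun t ht => hS ht₀ t.2 ht)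
        (Eventually.of_forall fun t => (hposX t t.2).2.le) (hev.mono fun t ht => hR ht₀ t.2 ht)
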